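/- Let $n,m,l\ge 1$ be integers. Let $\mathcal G$ be a labeled graph: finite sets $\mathcal U$ of nodes and $\mathcal E$ of edges, each edge $e$ having a source $s(e)\in\mathcal U$, a target $t(e)\in\mathcal U$ and a label $\sigma(e)\in\{1,\dots,m\}$. Let $\mathcal L_{\mathcal G,l}$ be the set of words $(\sigma(e_0),\dots,\sigma(e_{l-1}))$ with $e_0,\dots,e_{l-1}\in\mathcal E$ and $t(e_i)=s(e_{i+1})$ for $0\le i\le l-2$, and assume that it is non-empty. Let $A_1,\dots,A_m\in\mathbb R^{n\times n}$, and for a word $\sigma=(\sigma_0,\dots,\sigma_{l-1})$ put $A_\sigma=A_{\sigma_{l-1}}\cdots A_{\sigma_0}$. Let $\mathbb S^n=\{x\in\mathbb R^n:\|x\|=1\}$, $W>0$ and $B^n[W]=\{w\in\mathbb R^n:\|w\|\le W\}$. On $\Delta=\mathbb S^n\times\mathcal L_{\mathcal G,l}\times B^n[W]$ consider the probability measure $\pi=\mu^x\times\mu^\sigma\times\mu^w$, where $\mu^x$ and $\mu^\sigma$ are the uniform probability measures on $\mathbb S^n$ and $\mathcal L_{\mathcal G,l}$, and $\mu^w$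 is a probability measure on $B^n[W]$ such that every $S\subseteq B^n[W]$ with $\mu^w(S)>0$ has non-zero Lebesgue measure. For $P\succeq I$ (symmetric) write $\|v\|_P=\sqrt{v^TPv}$, let $\|P\|_F$ be the Frobenius norm and $\lambda^{\max}(P),\lambda^{\min}(P)$ the extreme eigenvalues. Fix $C\ge\sqrt n$. For a sample $\omega=(x_i,\sigma_i,w_i)_{i=1,\dots,N}\in\Delta^N$ consider the program $$\min_{\lambda\ge 0,\;P\in\mathbb R^{n\times n}}\bigl(\lambda,\|P\|_F\bigr)\quad\text{s.t.}\quad P\succeq I,\ \ \|P\|_F\le C,\ \ \|A_{\sigma_i}x_i+w_i\|_P\le\lambda^l\|x_i\|_P\ \ (i=1,\dots,N),$$ the minimum being taken in the lexicographic order. Let $d=n(n+1)/2$, $N\ge d$ and $\beta\in(0,1)$. Then for every $\omega\in\Delta^N$ the program has exactly one solution $(\lambda^*(\omega),P^*(\omega))$. With $$\overline\lambda(\omega)=\lambda^*(\omega)^l+\sqrt{\frac{\lambda^{\max}(P^*(\omega))}{\lambda^{\min}(P^*(\omega))}}\,W,\qquad V(\omega)=\bigl\{(x,\sigma,w)\in\Delta:\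 \|A_\sigma x\|_{P^*(\omega)}>\overline\lambda(\omega)\,\|x\|_{P^*(\omega)}\bigr\},$$ one has $$\pi^N\bigl(\{\omega\in\Delta^N:\ \pi(V(\omega))\le\varepsilon(\beta,N)\}\bigr)\ \ge\ 1-\beta,$$ where $\varepsilon(\beta,N)\in(0,1)$ is the unique solution $\varepsilon$ of $I_\varepsilon(d,N-d+1)=1-\beta$, with $I_x(a,b)=\int_0^xt^{a-1}(1-t)^{b-1}\,dt\big/\int_0^1t^{a-1}(1-t)^{b-1}\,dt$ the regularized incomplete beta function; equivalently $\sum_{i=0}^{d-1}\binom Ni\varepsilon^i(1-\varepsilon)^{N-i}=\beta$. -/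

import Mathlib

open MeasureTheory Matrix

noncomputable section

namespace CSLS

/-- A labeled directed graph with nodes `U`, edges `E` and labels in an `m`-element set. -/
structure LabeledGraph (U E : Type*) (m : ℕ) where
  /-- the node at which an edge starts -/
  src : E → U
  /-- the node at which an edge terminates -/
  tgt : E → U
  /-- the label of an edge -/
  label : E → Fin m

/-- The words of length `l` read along the paths of `l` consecutive edges. -/
def LabeledGraph.language {U E : Type*} {m : ℕ} (G : LabeledGraph U E m) (l : ℕ) :
    Set (Fin l → Fin m) :=
  {w | ∃ e : Fin l → E,
    (∀ i j : Fin l, (j : ℕ) = (i : ℕ) + 1 → G.tgt (e i) = G.src (e j)) ∧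
    ∀ i, w i = G.label (e i)}

/-- The matrix `A_{w(l-1)} ⋯ A_{w(1)} A_{w(0)}` of a word `w`. -/
def wordMatrix {n m l : ℕ} (A : Fin m → Matrix (Fin n) (Fin n) ℝ) (w : Fin l → Fin m) :
    Matrix (Fin n) (Fin n) ℝ :=
  (List.ofFn fun i => A (w i)).reverse.prod

/-- The space of samples `(x, σ, w)`: a point of the unit sphere, a word of length `l`,
and a noise vector in the closed ball of radius `W`. -/
abbrev Sample {U E : Type*} {m : ℕ} (G : LabeledGraph U E m) (n l : ℕ) (W : ℝ) : Type :=
  Metric.sphere (0 : EuclideanSpace ℝ (Fin n)) 1 × G.language l ×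
    Metric.closedBall (0 : EuclideanSpace ℝ (Fin n)) W

/-- The uniform probability measure on the unit sphere of `ℝⁿ`: normalized surface measure. -/
def sphereUniform (n : ℕ) : Measure (Metric.sphere (0 : EuclideanSpace ℝ (Fin n)) 1) :=
  ((volume : Measure (EuclideanSpace ℝ (Fin n))).toSphere Set.univ)⁻¹ •
    (volume : Measure (EuclideanSpace ℝ (Fin n))).toSphere

/-- The law of one sample: uniform on the sphere, uniform on the words, noise law `μw`,
all three independent. -/
def sampleMeasure {U E : Type*} {m : ℕ} (G : LabeledGraph U E m) (n l : ℕ) {W : ℝ}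
    (μw : Measure (Metric.closedBall (0 : EuclideanSpace ℝ (Fin n)) W)) :
    Measure (Sample G n l W) :=
  (sphereUniform n).prod
    ((ProbabilityTheory.uniformOn (Set.univ : Set (G.language l))).prod μw)

/-- The norm `‖v‖_P = √(vᵀ P v)`. -/
def quadNorm {n : ℕ} (P : Matrix (Fin n) (Fin n) ℝ) (v : Fin n → ℝ) : ℝ :=
  √(v ⬝ᵥ (P *ᵥ v))

/-- The Frobenius norm. -/
def frobNorm {n : ℕ} (P : Matrix (Fin n) (Fin n) ℝ) : ℝ :=
  √(∑ i, ∑ j, P i j ^ 2)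

/-- The largest eigenvalue of a real symmetric matrix. -/
def eigMax {n : ℕ} (P : Matrix (Fin n) (Fin n) ℝ) : ℝ := sSup (spectrum ℝ P)

/-- The smallest eigenvalue of a real symmetric matrix. -/
def eigMin {n : ℕ} (P : Matrix (Fin n) (Fin n) ℝ) : ℝ := sInf (spectrum ℝ P)

/-- `(lam, P)` satisfies the constraints of the sampled program: `lam ≥ 0`, `P ⪰ I`
(in particular `P` is symmetric), `‖P‖_F ≤ C`, and `‖A_σ x + w‖_P ≤ lam ^ l ‖x‖_P` for every
sample `(x, σ, w)`. -/
def IsFeasible {U E : Type*} {m n l N : ℕ} {W : ℝ} (G : LabeledGraph U E m)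
    (A : Fin m → Matrix (Fin n) (Fin n) ℝ) (C : ℝ) (ω : Fin N → Sample G n l W)
    (lam : ℝ) (P : Matrix (Fin n) (Fin n) ℝ) : Prop :=
  0 ≤ lam ∧ (P - 1).PosSemidef ∧ frobNorm P ≤ C ∧
    ∀ i, quadNorm P
        (wordMatrix A (ω i).2.1.1 *ᵥ (ω i).1.1.ofLp + (ω i).2.2.1.ofLp)
      ≤ lam ^ l * quadNorm P (ω i).1.1.ofLp

/-- `(lam, P)` solves the sampled program: it is feasible, and the objective
`(lam, ‖P‖_F)` is minimal in the lexicographic order. -/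
def IsSolution {U E : Type*} {m n l N : ℕ} {W : ℝ} (G : LabeledGraph U E m)
    (A : Fin m → Matrix (Fin n) (Fin n) ℝ) (C : ℝ) (ω : Fin N → Sample G n l W)
    (lam : ℝ) (P : Matrix (Fin n) (Fin n) ℝ) : Prop :=
  IsFeasible G A C ω lam P ∧
    ∀ (lam' : ℝ) (P' : Matrix (Fin n) (Fin n) ℝ), IsFeasible G A C ω lam' P' →
      toLex (lam, frobNorm P) ≤ toLex (lam', frobNorm P')

/-- The noise-corrected rate `lam ^ l + √(λmax(P) / λmin(P)) W`. -/
def lamBar {n : ℕ} (l : ℕ) (W lam : ℝ) (P : Matrix (Fin n) (Fin n) ℝ) : ℝ :=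
  lam ^ l + √(eigMax P / eigMin P) * W

/-- The samples `(x, σ, w)` with `‖A_σ x‖_P > lamBar ‖x‖_P`. -/
def violationSet {U E : Type*} {m n : ℕ} (G : LabeledGraph U E m)
    (A : Fin m → Matrix (Fin n) (Fin n) ℝ) (l : ℕ) (W lam : ℝ)
    (P : Matrix (Fin n) (Fin n) ℝ) : Set (Sample G n l W) :=
  {δ | quadNorm P (wordMatrix A δ.2.1.1 *ᵥ δ.1.1.ofLp)
    > lamBar l W lam P * quadNorm P δ.1.1.ofLp}

/-- The regularized incomplete beta function `I_x(a, b)`. -/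
def regIncBeta (a b x : ℝ) : ℝ :=
  (∫ t in (0 : ℝ)..x, t ^ (a - 1) * (1 - t) ^ (b - 1)) /
    ∫ t in (0 : ℝ)..1, t ^ (a - 1) * (1 - t) ^ (b - 1)

/-- The bound `ε(β, N)` for dimension `d`: the point of `[0, 1]` at which
`x ↦ I_x(d, N - d + 1) = 1 - ∑_{i ≤ d - 1} (N choose i) x ^ i (1 - x) ^ (N - i)`
takes the value `1 - β`. -/
def epsBound (d : ℕ) (β : ℝ) (N : ℕ) : ℝ :=
  Function.invFunOn (regIncBeta (d : ℝ) ((N : ℝ) - (d : ℝ) + 1)) (Set.Icc 0 1) (1 - β)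

end CSLS

end

/-! With t = λ^(2l) and squared norms, each sample constraint reads a(P) ≤ t b(P) with a, b linear
in P and b ≥ 1. At a fixed level t the feasible P form a compact convex set, and strict convexity of
the Frobenius norm makes the lexicographic minimiser unique. A violation of the noise-corrected rate
forces a violation of the noisy constraint (`quadNorm_add_gt`), so it suffices to bound the
probability that a fresh sample violates the constraint at the solution.

The solution is determined by d constraints, not by d + 1 as a count of the variables (t, P)
suggests: the constraints are homogeneous in P, so P can be normalised, and Helly's theorem in
dimension d applies (`exists_card_eq_sol_eq`). For fixed x and σ the noise vectors making a
constraint active lie on a null level set of a quadratic, so almost surely no further sample is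
active at a solution, and the minimal determining set of samples is unique. Let ν_k be the law of
the confidence y (the probability that a fresh sample is compatible with the solution) on the event
that none of k samples is redundant. Summing over the possible bases gives P(y ∈ D) = Σ_{k ≤ d}
C(m,k) ∫_D y^(m-k) dν_k for all m ≥ d (`measure_conf_mem`).

Bases may have fewer than d elements, so the ν_k are not known. But D = ℝ gives moment identities
for every m ≥ d, which combine into one identity for all polynomials q (`sum_integral_iterInt`).
Choosing q just above a multiple of s^(N-d) times the indicator of [0, 1 - ε) bounds P(y < 1 - ε) by
a beta tail, which equals β. -/

noncomputable section

namespace CSLS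

/-! ### Beta integrals and iterated integrals of polynomials -/

/-- The integral defining the beta function, at integer arguments and on `[0, y]`. -/
theorem integral_sub_pow_mul_pow (a j : ℕ) (y : ℝ) :
    ∫ s in (0 : ℝ)..y, (y - s) ^ a * s ^ j =
      (a.factorial * j.factorial / (a + j + 1).factorial : ℝ) * y ^ (a + j + 1) := by
  induction a generalizing j with
  | zero =>
    have h : ((0 + j + 1).factorial : ℝ) = (j + 1) * j.factorial := by
      rw [zero_add, Nat.factorial_succ]; push_cast; ring
    have hj : (j.factorial : ℝ) ≠ 0 := by positivity
    have hj' : (j + 1 : ℝ) ≠ 0 := by positivity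
    simp only [pow_zero, one_mul, integral_pow, h]
    simp
    field_simp
  | succ a ih =>
    have hj' : (j + 1 : ℝ) ≠ 0 := by positivity
    have key := intervalIntegral.integral_mul_deriv_eq_deriv_mul (a := (0 : ℝ)) (b := y)
      (u := fun s => (y - s) ^ (a + 1)) (v := fun s => s ^ (j + 1) / (j + 1))
      (u' := fun s => -((a + 1) * (y - s) ^ a)) (v' := fun s => s ^ j)
      (by
        intro x _
        have := ((hasDerivAt_id x).const_sub y).pow (a + 1)
        simpa [Pi.pow_def] using this)
      (by
        intro x _
        have := (hasDerivAt_pow (j + 1) x).div_const ((j : ℝ) + 1)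
        convert this using 1
        push_cast
        field_simp)
      (Continuous.intervalIntegrable (by fun_prop) _ _)
      (Continuous.intervalIntegrable (by fun_prop) _ _)
    rw [key]
    have : (fun s : ℝ => -((a + 1) * (y - s) ^ a) * (s ^ (j + 1) / (j + 1))) =
        fun s => (-((a + 1) / (j + 1)) : ℝ) * ((y - s) ^ a * s ^ (j + 1)) := by
      funext s; field_simp
    rw [this, intervalIntegral.integral_const_mul, ih]
    have h1 : a + (j + 1) + 1 = a + 1 + j + 1 := by ring
    rw [h1, Nat.factorial_succ j, Nat.factorial_succ a]
    push_cast
    field_simp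
    simp

/-- The `(d - k)`-fold iterated integral of `q` from `0`, for `k ≤ d`. -/
def iterInt (d k : ℕ) (q : ℝ → ℝ) (y : ℝ) : ℝ :=
  if k = d then q y else (∫ s in (0 : ℝ)..y, (y - s) ^ (d - 1 - k) * q s) / (d - 1 - k).factorial

theorem iterInt_pow {d k : ℕ} (hk : k ≤ d) (j : ℕ) (y : ℝ) :
    iterInt d k (fun s => s ^ j) y =
      (j.factorial / (j + d - k).factorial : ℝ) * y ^ (j + d - k) := by
  unfold iterInt
  split_ifs with h
  · subst h
    have : (j.factorial : ℝ) ≠ 0 := by positivity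
    simp [this]
  · have h1 : d - 1 - k + j + 1 = j + d - k := by omega
    have : ((d - 1 - k).factorial : ℝ) ≠ 0 := by positivity
    rw [integral_sub_pow_mul_pow, h1]
    field_simp

theorem iterInt_const_mul {d k : ℕ} (c : ℝ) (f : ℝ → ℝ) (y : ℝ) :
    iterInt d k (fun s => c * f s) y = c * iterInt d k f y := by
  unfold iterInt
  split_ifs with h
  · rfl
  · simp_rw [mul_left_comm _ c, intervalIntegral.integral_const_mul, mul_div_assoc]

theorem iterInt_sum {d k : ℕ} {ι : Type*} (s : Finset ι) (f : ι → ℝ → ℝ)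
    (hf : ∀ i ∈ s, Continuous (f i)) (y : ℝ) :
    iterInt d k (fun x => ∑ i ∈ s, f i x) y = ∑ i ∈ s, iterInt d k (f i) y := by
  unfold iterInt
  split_ifs with h
  · rfl
  · simp_rw [Finset.mul_sum]
    rw [intervalIntegral.integral_finsetSum, Finset.sum_div]
    intro i hi
    have := hf i hi
    exact Continuous.intervalIntegrable (by fun_prop) _ _

theorem iterInt_mono {d k : ℕ} {f g : ℝ → ℝ} {y : ℝ} (hy : 0 ≤ y)
    (hf : Continuous f) (hg : Continuous g) (h : ∀ s ∈ Set.Icc 0 y, f s ≤ g s) :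
    iterInt d k f y ≤ iterInt d k g y := by
  unfold iterInt
  split_ifs with hk
  · exact h y ⟨hy, le_rfl⟩
  · gcongr
    apply intervalIntegral.integral_mono_on hy
      (Continuous.intervalIntegrable (by fun_prop) _ _)
      (Continuous.intervalIntegrable (by fun_prop) _ _)
    intro s hs
    have : 0 ≤ y - s := by linarith [hs.2]
    have := h s hs
    gcongr

theorem iterInt_polynomial {d k : ℕ} (hk : k ≤ d) (q : Polynomial ℝ) (y : ℝ) :
    iterInt d k (fun s => q.eval s) y = ∑ j ∈ q.support,
      q.coeff j * ((j.factorial / (j + d - k).factorial : ℝ) * y ^ (j + d - k)) := by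
  have : (fun s => q.eval s) = fun s => ∑ j ∈ q.support, q.coeff j * s ^ j := by
    funext s; rw [Polynomial.eval_eq_sum, Polynomial.sum]
  rw [this, iterInt_sum _ _ (fun i _ => by fun_prop)]
  refine Finset.sum_congr rfl fun j _ => ?_
  rw [iterInt_const_mul, iterInt_pow hk]

theorem continuous_iterInt_polynomial {d k : ℕ} (hk : k ≤ d) (q : Polynomial ℝ) :
    Continuous (iterInt d k (fun s => q.eval s)) := by
  have : iterInt d k (fun s => q.eval s) = _ := funext (iterInt_polynomial hk q)
  rw [this]
  fun_prop

theorem integrable_of_ae_mem_Icc {ν : Measure ℝ} [IsFiniteMeasure ν]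
    (hν : ∀ᵐ y ∂ν, y ∈ Set.Icc (0 : ℝ) 1) {f : ℝ → ℝ} (hf : Continuous f) :
    Integrable f ν := by
  obtain ⟨C, hC⟩ := (isCompact_Icc (a := (0 : ℝ)) (b := 1)).exists_bound_of_continuousOn
    hf.continuousOn
  refine Integrable.of_bound hf.aestronglyMeasurable C ?_
  filter_upwards [hν] with y hy using hC y hy

/-! ### From moment identities to a beta tail bound -/

section Moments

variable {d : ℕ} {ν : ℕ → Measure ℝ} [∀ k, IsFiniteMeasure (ν k)]

/-- The moment identities, written as a single identity for polynomials. -/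
theorem sum_integral_iterInt (hν : ∀ k, ∀ᵐ y ∂ν k, y ∈ Set.Icc (0 : ℝ) 1)
    (hmom : ∀ m, d ≤ m →
      ∑ k ∈ Finset.range (d + 1), (m.choose k : ℝ) * ∫ y, y ^ (m - k) ∂ν k = 1)
    (q : Polynomial ℝ) :
    ∑ k ∈ Finset.range (d + 1),
      (k.factorial : ℝ)⁻¹ * ∫ y, iterInt d k (fun s => q.eval s) y ∂ν k =
      iterInt d 0 (fun s => q.eval s) 1 := by
  rw [iterInt_polynomial (Nat.zero_le d)]
  -- On the monomial s^j the claim is the moment identity for m = j + d, multiplied by j!/(j+d)!.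
  have h1 : ∀ k ∈ Finset.range (d + 1),
      (k.factorial : ℝ)⁻¹ * ∫ y, iterInt d k (fun s => q.eval s) y ∂ν k =
      ∑ j ∈ q.support, q.coeff j * (j.factorial / (j + d).factorial : ℝ) *
        (((j + d).choose k : ℝ) * ∫ y, y ^ (j + d - k) ∂ν k) := by
    intro k hk
    have hk : k ≤ d := by simpa [Nat.lt_succ_iff] using hk
    simp_rw [iterInt_polynomial hk]
    rw [integral_finsetSum _ (fun j _ => integrable_of_ae_mem_Icc (hν k) (by fun_prop)),
      Finset.mul_sum]
    refine Finset.sum_congr rfl fun j _ => ?_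
    rw [integral_const_mul, integral_const_mul, Nat.cast_choose ℝ (show k ≤ j + d by omega)]
    field_simp
  rw [Finset.sum_congr rfl h1, Finset.sum_comm]
  refine Finset.sum_congr rfl fun j _ => ?_
  rw [← Finset.mul_sum, hmom (j + d) (by omega)]
  simp

/-- Weak duality, with q as certificate: iterated integration is monotone, and it turns N!/(N-d)!
s^(N-d) into k! C(N,k) y^(N-k), so each summand is dominated by the matching term of
`sum_integral_iterInt`. -/
theorem sum_setIntegral_le_of_polynomial {N : ℕ} (hN : d ≤ N)
    (hν : ∀ k, ∀ᵐ y ∂ν k, y ∈ Set.Icc (0 : ℝ) 1)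
    (hmom : ∀ m, d ≤ m →
      ∑ k ∈ Finset.range (d + 1), (m.choose k : ℝ) * ∫ y, y ^ (m - k) ∂ν k = 1)
    {u : ℝ} (q : Polynomial ℝ) (hq0 : ∀ s ∈ Set.Icc (0 : ℝ) 1, 0 ≤ q.eval s)
    (hq : ∀ s ∈ Set.Icc (0 : ℝ) 1, s < u →
      (N.factorial / (N - d).factorial : ℝ) * s ^ (N - d) ≤ q.eval s) :
    ∑ k ∈ Finset.range (d + 1), (N.choose k : ℝ) * ∫ y in Set.Iio u, y ^ (N - k) ∂ν k ≤
      iterInt d 0 (fun s => q.eval s) 1 := by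
  rw [← sum_integral_iterInt hν hmom q]
  refine Finset.sum_le_sum fun k hk => ?_
  have hk : k ≤ d := by simpa [Nat.lt_succ_iff] using hk
  rw [← integral_indicator measurableSet_Iio, ← integral_const_mul, ← integral_const_mul]
  apply integral_mono_ae
  · exact ((integrable_of_ae_mem_Icc (hν k) (by fun_prop)).indicator measurableSet_Iio).const_mul _
  · exact (integrable_of_ae_mem_Icc (hν k) (continuous_iterInt_polynomial hk q)).const_mul _
  filter_upwards [hν k] with y hy
  by_cases hyu : y < u
  · have h1 := iterInt_mono (d := d) (k := k) hy.1
      (f := fun s => (N.factorial / (N - d).factorial : ℝ) * s ^ (N - d))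
      (g := fun s => q.eval s) (by fun_prop) (by fun_prop)
      (fun s hs => hq s ⟨hs.1, hs.2.trans hy.2⟩ (hs.2.trans_lt hyu))
    rw [iterInt_const_mul, iterInt_pow hk] at h1
    have h2 : N - d + d - k = N - k := by omega
    rw [h2] at h1
    rw [Set.indicator_of_mem (by exact hyu), Nat.cast_choose ℝ (hk.trans hN)]
    calc _ = (k.factorial : ℝ)⁻¹ * ((N.factorial / (N - d).factorial : ℝ) *
          (((N - d).factorial / (N - k).factorial : ℝ) * y ^ (N - k))) := by field_simp
      _ ≤ _ := by gcongr
  · rw [Set.indicator_of_notMem (by exact hyu), mul_zero]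
    have h1 := iterInt_mono (d := d) (k := k) hy.1
      (f := fun s => (0 : ℝ) * s ^ 0)
      (g := fun s => q.eval s) (by fun_prop) (by fun_prop)
      (fun s hs => by simpa using hq0 s ⟨hs.1, hs.2.trans hy.2⟩)
    rw [iterInt_const_mul, zero_mul] at h1
    positivity

/-- Continuous approximation of the indicator of `(-∞, u)`. -/
theorem exists_cutoff {u u' : ℝ} (h : u < u') :
    ∃ χ : ℝ → ℝ, Continuous χ ∧ (∀ s, 0 ≤ χ s ∧ χ s ≤ 1) ∧ (∀ s, s < u → χ s = 1) ∧
      ∀ s, u' ≤ s → χ s = 0 := by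
  have h' : 0 < u' - u := sub_pos.2 h
  refine ⟨fun s => max 0 (min 1 ((u' - s) / (u' - u))), by fun_prop, fun s => ⟨le_max_left _ _,
    max_le zero_le_one (min_le_left _ _)⟩, fun s hs => ?_, fun s hs => ?_⟩
  · have : 1 ≤ (u' - s) / (u' - u) := by rw [le_div_iff₀ h']; linarith
    simp [this]
  · have : (u' - s) / (u' - u) ≤ 0 := div_nonpos_of_nonpos_of_nonneg (by linarith) h'.le
    simp [this]

/-- The optimal certificate is a truncated monomial, which is not a polynomial; a continuous cutoff
followed by Weierstrass approximation costs only η. -/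
theorem sum_setIntegral_le_add (hd : 0 < d) {N : ℕ} (hN : d ≤ N)
    (hν : ∀ k, ∀ᵐ y ∂ν k, y ∈ Set.Icc (0 : ℝ) 1)
    (hmom : ∀ m, d ≤ m →
      ∑ k ∈ Finset.range (d + 1), (m.choose k : ℝ) * ∫ y, y ^ (m - k) ∂ν k = 1)
    {u u' : ℝ} (hu : u < u') (hu0 : 0 ≤ u') (hu1 : u' ≤ 1) {η : ℝ} (hη : 0 < η) :
    ∑ k ∈ Finset.range (d + 1), (N.choose k : ℝ) * ∫ y in Set.Iio u, y ^ (N - k) ∂ν k ≤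
      (N.factorial / (N - d).factorial : ℝ) / (d - 1).factorial *
        (∫ s in (0 : ℝ)..u', (1 - s) ^ (d - 1) * s ^ (N - d)) + η := by
  obtain ⟨χ, hχc, hχ01, hχ1, hχ0⟩ := exists_cutoff hu
  set c : ℝ := N.factorial / (N - d).factorial with hc
  have hc0 : 0 ≤ c := by positivity
  set f : ℝ → ℝ := fun s => c * s ^ (N - d) * χ s with hf
  have hfc : Continuous f := by fun_prop
  obtain ⟨p, hp⟩ := exists_polynomial_near_of_continuousOn 0 1 f hfc.continuousOn (η / 2)
    (by positivity)
  -- The shift by η/2 places the approximation above f while keeping it below f + η.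
  set q : Polynomial ℝ := p + Polynomial.C (η / 2) with hqdef
  have hq1 : ∀ s ∈ Set.Icc (0 : ℝ) 1, f s ≤ q.eval s ∧ q.eval s ≤ f s + η := by
    intro s hs
    have := abs_lt.1 (hp s hs)
    simp only [hqdef, Polynomial.eval_add, Polynomial.eval_C]
    constructor <;> linarith [this.1, this.2]
  have hf0 : ∀ s ∈ Set.Icc (0 : ℝ) 1, 0 ≤ f s := fun s hs =>
    mul_nonneg (mul_nonneg hc0 (pow_nonneg hs.1 _)) (hχ01 s).1
  refine (sum_setIntegral_le_of_polynomial hN hν hmom q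
    (fun s hs => (hf0 s hs).trans (hq1 s hs).1) (u := u) ?_).trans ?_
  · intro s hs hsu
    refine le_trans ?_ (hq1 s hs).1
    simp [hf, hχ1 s hsu, hc]
  · have h1 := iterInt_mono (d := d) (k := 0) zero_le_one (f := fun s => q.eval s)
      (g := fun s => f s + η) (by fun_prop) (by fun_prop) (fun s hs => (hq1 s hs).2)
    refine h1.trans ?_
    have hd0 : ¬ (0 = d) := by omega
    have hfact : (1 : ℝ) ≤ (d - 1).factorial := by
      exact_mod_cast Nat.factorial_pos _
    simp only [iterInt, if_neg hd0, Nat.sub_zero, mul_add]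
    rw [intervalIntegral.integral_add (Continuous.intervalIntegrable (by fun_prop) _ _)
      (Continuous.intervalIntegrable (by fun_prop) _ _), add_div]
    refine add_le_add ?_ ?_
    · rw [div_mul_eq_mul_div]
      gcongr
      rw [← intervalIntegral.integral_add_adjacent_intervals (b := u')
        (Continuous.intervalIntegrable (by fun_prop) _ _)
        (Continuous.intervalIntegrable (by fun_prop) _ _)]
      have h2 : ∫ s in u'..1, (1 - s) ^ (d - 1) * f s = 0 := by
        rw [intervalIntegral.integral_congr (g := fun _ => (0 : ℝ))]
        · simp
        · intro s hs
          rw [Set.uIcc_of_le hu1] at hs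
          simp [hf, hχ0 s hs.1]
      rw [h2, add_zero, ← intervalIntegral.integral_const_mul]
      apply intervalIntegral.integral_mono_on hu0
        (Continuous.intervalIntegrable (by fun_prop) _ _)
        (Continuous.intervalIntegrable (by fun_prop) _ _)
      intro s hs
      have e1 : 0 ≤ 1 - s := by linarith [hs.2]
      have e2 : 0 ≤ s := hs.1
      have e3 := (hχ01 s).2
      calc (1 - s) ^ (d - 1) * f s = c * ((1 - s) ^ (d - 1) * s ^ (N - d)) * χ s := by
            simp only [hf]; ring
        _ ≤ c * ((1 - s) ^ (d - 1) * s ^ (N - d)) * 1 := by gcongr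
        _ = _ := mul_one _
    -- The constant η contributes exactly η/d!, which is at most η.
    · rw [intervalIntegral.integral_mul_const]
      have h3 := integral_sub_pow_mul_pow (d - 1) 0 1
      simp only [pow_zero, mul_one, one_pow, Nat.factorial_zero, Nat.cast_one, add_zero] at h3
      rw [h3]
      have h4 : ((d - 1).factorial : ℝ) ≤ (d - 1 + 1).factorial := by
        exact_mod_cast Nat.factorial_le (by omega)
      have h5 : ((d - 1).factorial / (d - 1 + 1).factorial : ℝ) ≤ 1 :=
        div_le_one_of_le₀ h4 (by positivity)
      rw [div_le_iff₀ (by linarith)]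
      nlinarith

/-- The denominator is the beta function at integers, (d-1)!(N-d)!/N!. -/
theorem regIncBeta_eq (hd : 0 < d) {N : ℕ} (hN : d ≤ N) {x : ℝ} (hx0 : 0 ≤ x) (hx1 : x ≤ 1) :
    regIncBeta d ((N : ℝ) - d + 1) x =
      (N.factorial / (N - d).factorial : ℝ) / (d - 1).factorial *
        ∫ t in (0 : ℝ)..x, t ^ (d - 1) * (1 - t) ^ (N - d) := by
  have e : ∀ y : ℝ, 0 ≤ y → y ≤ 1 →
      (∫ t in (0 : ℝ)..y, t ^ ((d : ℝ) - 1) * (1 - t) ^ ((N : ℝ) - d + 1 - 1)) =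
      ∫ t in (0 : ℝ)..y, t ^ (d - 1) * (1 - t) ^ (N - d) := by
    intro y _ _
    refine intervalIntegral.integral_congr fun t _ => ?_
    have h1 : (d : ℝ) - 1 = ((d - 1 : ℕ) : ℝ) := by rw [Nat.cast_sub hd]; simp
    have h2 : (N : ℝ) - d + 1 - 1 = ((N - d : ℕ) : ℝ) := by rw [Nat.cast_sub hN]; ring
    simp only [h1, h2, Real.rpow_natCast]
  have h3 := integral_sub_pow_mul_pow (N - d) (d - 1) 1
  have h4 : N - d + (d - 1) + 1 = N := by omega
  rw [h4] at h3
  unfold regIncBeta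
  rw [e x hx0 hx1, e 1 zero_le_one le_rfl]
  have h5 : ∫ t in (0 : ℝ)..1, t ^ (d - 1) * (1 - t) ^ (N - d) =
      ∫ t in (0 : ℝ)..1, (1 - t) ^ (N - d) * t ^ (d - 1) := by
    simp_rw [mul_comm]
  rw [h5, h3]
  have : ((N - d).factorial : ℝ) ≠ 0 := by positivity
  have : ((d - 1).factorial : ℝ) ≠ 0 := by positivity
  have : (N.factorial : ℝ) ≠ 0 := by positivity
  field_simp
  simp

theorem regIncBeta_one (hd : 0 < d) {N : ℕ} (hN : d ≤ N) :
    regIncBeta d ((N : ℝ) - d + 1) 1 = 1 := by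
  rw [regIncBeta_eq hd hN zero_le_one le_rfl]
  have h3 := integral_sub_pow_mul_pow (N - d) (d - 1) 1
  have h4 : N - d + (d - 1) + 1 = N := by omega
  rw [h4] at h3
  simp_rw [mul_comm (_ ^ (d - 1))]
  rw [h3]
  have : ((N - d).factorial : ℝ) ≠ 0 := by positivity
  have : ((d - 1).factorial : ℝ) ≠ 0 := by positivity
  have : (N.factorial : ℝ) ≠ 0 := by positivity
  field_simp
  simp

theorem one_sub_regIncBeta (hd : 0 < d) {N : ℕ} (hN : d ≤ N) {x : ℝ} (hx0 : 0 ≤ x)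
    (hx1 : x ≤ 1) :
    1 - regIncBeta d ((N : ℝ) - d + 1) x =
      (N.factorial / (N - d).factorial : ℝ) / (d - 1).factorial *
        ∫ s in (0 : ℝ)..(1 - x), (1 - s) ^ (d - 1) * s ^ (N - d) := by
  have h1 := intervalIntegral.integral_comp_sub_left (a := 0) (b := 1 - x)
    (fun t : ℝ => t ^ (d - 1) * (1 - t) ^ (N - d)) 1
  simp only [sub_sub_cancel, sub_zero] at h1
  have h2 := regIncBeta_one hd hN
  rw [regIncBeta_eq hd hN zero_le_one le_rfl,
    ← intervalIntegral.integral_add_adjacent_intervals (b := x)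
        (Continuous.intervalIntegrable (by fun_prop) 0 x)
        (Continuous.intervalIntegrable (by fun_prop) x 1)] at h2
  rw [h1, regIncBeta_eq hd hN hx0 hx1]
  linear_combination -h2

theorem epsBound_spec (hd : 0 < d) {N : ℕ} (hN : d ≤ N) {β : ℝ} (h0 : 0 < β) (h1 : β < 1) :
    0 < epsBound d β N ∧ epsBound d β N ≤ 1 ∧
      regIncBeta d ((N : ℝ) - d + 1) (epsBound d β N) = 1 - β := by
  have hc : ContinuousOn (regIncBeta d ((N : ℝ) - d + 1)) (Set.Icc 0 1) := by
    refine ContinuousOn.congr (f := fun x => (N.factorial / (N - d).factorial : ℝ) /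
      (d - 1).factorial * ∫ t in (0 : ℝ)..x, t ^ (d - 1) * (1 - t) ^ (N - d)) ?_
      (fun x hx => regIncBeta_eq hd hN hx.1 hx.2)
    refine Continuous.continuousOn (continuous_const.mul ?_)
    exact intervalIntegral.continuous_primitive
      (fun a b => Continuous.intervalIntegrable (by fun_prop) a b) 0
  have hz : regIncBeta d ((N : ℝ) - d + 1) 0 = 0 := by simp [regIncBeta]
  -- The intermediate value theorem supplies a preimage, so `Function.invFunOn` does not fall back
  -- on an arbitrary value.
  have hex : ∃ x ∈ Set.Icc (0 : ℝ) 1, regIncBeta d ((N : ℝ) - d + 1) x = 1 - β := by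
    have := intermediate_value_Icc zero_le_one hc
    rw [hz, regIncBeta_one hd hN] at this
    exact this ⟨by linarith, by linarith⟩
  have hmem := Function.invFunOn_mem hex
  have heq := Function.invFunOn_eq hex
  change epsBound d β N ∈ _ at hmem
  change regIncBeta d ((N : ℝ) - d + 1) (epsBound d β N) = 1 - β at heq
  refine ⟨lt_of_le_of_ne hmem.1 ?_, hmem.2, heq⟩
  intro h
  rw [← h, hz] at heq
  linarith

/-- The tail bound that follows from the moment identities. -/
theorem sum_setIntegral_le_one_sub_regIncBeta (hd : 0 < d) {N : ℕ} (hN : d ≤ N)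
    (hν : ∀ k, ∀ᵐ y ∂ν k, y ∈ Set.Icc (0 : ℝ) 1)
    (hmom : ∀ m, d ≤ m →
      ∑ k ∈ Finset.range (d + 1), (m.choose k : ℝ) * ∫ y, y ^ (m - k) ∂ν k = 1)
    {x : ℝ} (hx0 : 0 < x) (hx1 : x ≤ 1) :
    ∑ k ∈ Finset.range (d + 1), (N.choose k : ℝ) * ∫ y in Set.Iio (1 - x), y ^ (N - k) ∂ν k ≤
      1 - regIncBeta d ((N : ℝ) - d + 1) x := by
  rw [one_sub_regIncBeta hd hN hx0.le hx1]
  have hcont : Continuous fun v : ℝ => (N.factorial / (N - d).factorial : ℝ) /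
      (d - 1).factorial * ∫ s in (0 : ℝ)..v, (1 - s) ^ (d - 1) * s ^ (N - d) :=
    continuous_const.mul (intervalIntegral.continuous_primitive
      (fun a b => Continuous.intervalIntegrable (by fun_prop) a b) 0)
  -- The cutoff needs room to the right of 1 - x, available because x > 0; continuity of the bound
  -- then lets v decrease to 1 - x.
  refine ge_of_tendsto ((hcont.tendsto (1 - x)).mono_left
    (nhdsWithin_le_nhds (s := Set.Ioi (1 - x)))) ?_
  filter_upwards [Ioo_mem_nhdsGT (show 1 - x < 1 by linarith)] with v hv
  refine le_of_forall_pos_le_add fun η hη => ?_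
  exact sum_setIntegral_le_add hd hN hν hmom hv.1 (by linarith [hv.1]) hv.2.le hη

end Moments

/-! ### Lexicographic scenario programs: solutions and inactive constraints -/

/-- The data of a family of lexicographic programs: minimize `(t, ‖P‖)` over `t ≥ 0` and `P ∈ X`
subject to `a δ P ≤ t * b δ P` for all `δ` in a set of samples. -/
structure ScenarioProgram (Δ E : Type*) [TopologicalSpace Δ] [NormedAddCommGroup E]
    [InnerProductSpace ℝ E] where
  /-- the numerators -/
  a : Δ → E →ₗ[ℝ] ℝ
  /-- the denominators -/
  b : Δ → E →ₗ[ℝ] ℝ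
  /-- the domain of `P` -/
  X : Set E
  /-- a functional that is positive on `X` -/
  T : E →ₗ[ℝ] ℝ
  isCompact_X : IsCompact X
  convex_X : Convex ℝ X
  nonempty_X : X.Nonempty
  a_nonneg : ∀ δ, ∀ P ∈ X, 0 ≤ a δ P
  one_le_b : ∀ δ, ∀ P ∈ X, 1 ≤ b δ P
  T_pos : ∀ P ∈ X, 0 < T P
  continuous_a : Continuous fun x : Δ × E => a x.1 x.2
  continuous_b : Continuous fun x : Δ × E => b x.1 x.2

namespace ScenarioProgram

variable {Δ E : Type*} [TopologicalSpace Δ] [NormedAddCommGroup E] [InnerProductSpace ℝ E]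
  (p : ScenarioProgram Δ E)

/-- The constraints imposed by the samples in `S`. -/
def Feasible (S : Set Δ) (θ : ℝ × E) : Prop :=
  0 ≤ θ.1 ∧ θ.2 ∈ p.X ∧ ∀ δ ∈ S, p.a δ θ.2 ≤ θ.1 * p.b δ θ.2

/-- Lexicographic optimality among the feasible points. -/
def Optimal (S : Set Δ) (θ : ℝ × E) : Prop :=
  p.Feasible S θ ∧ ∀ θ' : ℝ × E, p.Feasible S θ' → θ.1 < θ'.1 ∨ (θ.1 = θ'.1 ∧ ‖θ.2‖ ≤ ‖θ'.2‖)

variable {p}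

theorem Feasible.mono {S S' : Set Δ} (h : S ⊆ S') {θ : ℝ × E} (hθ : p.Feasible S' θ) :
    p.Feasible S θ :=
  ⟨hθ.1, hθ.2.1, fun δ hδ => hθ.2.2 δ (h hδ)⟩

theorem continuous_a_apply (δ : Δ) : Continuous (p.a δ) :=
  p.continuous_a.comp (Continuous.prodMk_right δ)

theorem continuous_b_apply (δ : Δ) : Continuous (p.b δ) :=
  p.continuous_b.comp (Continuous.prodMk_right δ)

theorem isClosed_feasible (S : Set Δ) : IsClosed {θ | p.Feasible S θ} := by
  have : {θ | p.Feasible S θ} = {θ : ℝ × E | 0 ≤ θ.1} ∩ (Prod.snd ⁻¹' p.X ∩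
      ⋂ δ ∈ S, {θ : ℝ × E | p.a δ θ.2 ≤ θ.1 * p.b δ θ.2}) := by
    ext θ; simp [Feasible]
  rw [this]
  refine (isClosed_le continuous_const continuous_fst).inter
    ((p.isCompact_X.isClosed.preimage continuous_snd).inter
      (isClosed_biInter fun δ _ => isClosed_le ?_ ?_))
  · exact (continuous_a_apply δ).comp continuous_snd
  · exact continuous_fst.mul ((continuous_b_apply δ).comp continuous_snd)

variable (p) in
theorem exists_feasible_bound [CompactSpace Δ] : ∃ M : ℝ, 0 ≤ M ∧
    ∀ S : Set Δ, ∀ P ∈ p.X, p.Feasible S (M, P) := by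
  have hK : IsCompact ((Set.univ : Set Δ) ×ˢ p.X) := isCompact_univ.prod p.isCompact_X
  obtain ⟨M, hM⟩ := hK.exists_bound_of_continuousOn p.continuous_a.continuousOn
  refine ⟨max M 0, le_max_right _ _, fun S P hP => ⟨le_max_right _ _, hP, fun δ _ => ?_⟩⟩
  have h1 := hM (δ, P) ⟨trivial, hP⟩
  have h2 := p.one_le_b δ P hP
  calc p.a δ P ≤ M := (le_abs_self _).trans h1
    _ ≤ max M 0 := le_max_left _ _
    _ ≤ max M 0 * p.b δ P := le_mul_of_one_le_right (le_max_right _ _) h2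

variable (p) in
theorem exists_optimal [CompactSpace Δ] (S : Set Δ) : ∃ θ, p.Optimal S θ := by
  obtain ⟨M, hM0, hM⟩ := p.exists_feasible_bound
  obtain ⟨P₀, hP₀⟩ := p.nonempty_X
  have hK : IsCompact ({θ | p.Feasible S θ} ∩ Set.Icc 0 M ×ˢ p.X) :=
    (isCompact_Icc.prod p.isCompact_X).inter_left (isClosed_feasible S)
  obtain ⟨θ₁, hθ₁, hmin₁⟩ := hK.exists_isMinOn ⟨(M, P₀), hM S P₀ hP₀, ⟨hM0, le_rfl⟩, hP₀⟩
    continuous_fst.continuousOn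
  have hmin₁' : ∀ θ, p.Feasible S θ → θ₁.1 ≤ θ.1 := by
    intro θ hθ
    rcases le_total θ.1 M with h | h
    · exact hmin₁ ⟨hθ, ⟨hθ.1, h⟩, hθ.2.1⟩
    · exact hθ₁.2.1.2.trans h
  -- The second objective is minimised on the compact slice of minimal level.
  have hK₂ : IsCompact (({θ | p.Feasible S θ} ∩ Set.Icc 0 M ×ˢ p.X) ∩ {θ | θ.1 = θ₁.1}) :=
    hK.inter_right (isClosed_eq continuous_fst continuous_const)
  obtain ⟨θ₂, hθ₂, hmin₂⟩ := hK₂.exists_isMinOn ⟨θ₁, hθ₁, rfl⟩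
    (f := fun θ : ℝ × E => ‖θ.2‖) (by fun_prop)
  refine ⟨θ₂, hθ₂.1.1, fun θ hθ => ?_⟩
  have h2 : θ₂.1 = θ₁.1 := hθ₂.2
  rw [h2]
  rcases (hmin₁' θ hθ).lt_or_eq with h | h
  · exact Or.inl h
  · refine Or.inr ⟨h, hmin₂ ⟨⟨hθ, ?_, hθ.2.1⟩, h.symm⟩⟩
    rw [← h]; exact hθ₁.2.1

/-- At a common level t the constraints are linear in P; jointly in (t, P) they are only bilinear.
-/
theorem Feasible.convex_comb {S : Set Δ} {t : ℝ} {P Q : E} (hP : p.Feasible S (t, P))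
    (hQ : p.Feasible S (t, Q)) {u v : ℝ} (hu : 0 ≤ u) (hv : 0 ≤ v) (huv : u + v = 1) :
    p.Feasible S (t, u • P + v • Q) := by
  refine ⟨hP.1, p.convex_X hP.2.1 hQ.2.1 hu hv huv, fun δ hδ => ?_⟩
  have h1 := hP.2.2 δ hδ
  have h2 := hQ.2.2 δ hδ
  simp only [map_add, map_smul, smul_eq_mul] at *
  nlinarith

/-- Two solutions share level and norm, and their midpoint is feasible. By the parallelogram law it
would have smaller norm unless they coincide. -/
theorem Optimal.eq {S : Set Δ} {θ θ' : ℝ × E} (h : p.Optimal S θ) (h' : p.Optimal S θ') :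
    θ = θ' := by
  obtain ⟨t, P⟩ := θ
  obtain ⟨t', P'⟩ := θ'
  have h1 := h.2 _ h'.1
  have h2 := h'.2 _ h.1
  simp only at h1 h2
  have ht : t = t' := by
    rcases h1 with h1 | h1
    · rcases h2 with h2 | h2
      · linarith
      · exact h2.1.symm
    · exact h1.1
  subst ht
  have hn : ‖P‖ = ‖P'‖ := by
    simp only [lt_irrefl, true_and, false_or] at h1 h2
    exact le_antisymm h1 h2
  have hmid := h.2 _ (h.1.convex_comb h'.1 (u := 1 / 2) (v := 1 / 2) (by norm_num) (by norm_num)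
    (by norm_num))
  simp only [lt_irrefl, true_and, false_or] at hmid
  have hpar := parallelogram_law_with_norm ℝ P P'
  rw [← smul_add, norm_smul] at hmid
  have h3 : ‖P - P'‖ * ‖P - P'‖ ≤ 0 := by
    have : 2 * ‖P‖ ≤ ‖P + P'‖ := by
      have : ‖(1 / 2 : ℝ)‖ = 1 / 2 := by norm_num
      rw [this] at hmid
      linarith
    rw [← hn] at hpar
    nlinarith [norm_nonneg P]
  have h4 : ‖P - P'‖ = 0 := by nlinarith [norm_nonneg (P - P')]
  rw [sub_eq_zero.1 (norm_eq_zero.1 h4)]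

/-- If all constraints hold strictly at level `t`, then the level can be decreased. -/
theorem exists_feasible_lt {S : Set Δ} (hS : S.Finite) (hne : S.Nonempty) {t : ℝ}
    {P : E} (hP : P ∈ p.X) (h : ∀ δ ∈ S, p.a δ P < t * p.b δ P) :
    ∃ t' < t, p.Feasible S (t', P) := by
  classical
  -- The new level is the largest ratio a/b over the finite set S.
  obtain ⟨δ₀, hδ₀, hmax⟩ := hS.toFinset.exists_max_image (fun δ => p.a δ P / p.b δ P)
    (by simpa using hne)
  have hb : ∀ δ, 0 < p.b δ P := fun δ => zero_lt_one.trans_le (p.one_le_b δ P hP)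
  refine ⟨p.a δ₀ P / p.b δ₀ P, ?_, ?_, hP, fun δ hδ => ?_⟩
  · rw [div_lt_iff₀ (hb _)]; exact h _ (by simpa using hδ₀)
  · exact div_nonneg (p.a_nonneg _ _ hP) (hb _).le
  · have := hmax δ (by simpa using hδ)
    exact (div_le_iff₀ (hb δ)).1 this

variable (p) in
/-- The samples whose constraint holds at `θ`. -/
def sat (θ : ℝ × E) : Set Δ := {δ | p.a δ θ.2 ≤ θ.1 * p.b δ θ.2}

variable [CompactSpace Δ]

variable (p) in
/-- The solution of the program with samples `S`. -/
def sol (S : Set Δ) : ℝ × E := (p.exists_optimal S).choose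

variable (p) in
theorem optimal_sol (S : Set Δ) : p.Optimal S (p.sol S) := (p.exists_optimal S).choose_spec

theorem Optimal.eq_sol {S : Set Δ} {θ : ℝ × E} (h : p.Optimal S θ) : p.sol S = θ :=
  (p.optimal_sol S).eq h

theorem subset_sat_sol (S : Set Δ) : S ⊆ p.sat (p.sol S) := fun δ hδ => (p.optimal_sol S).1.2.2 δ hδ

theorem sol_eq_of_subset_sat {S S' : Set Δ} (h : S ⊆ S') (h' : S' ⊆ p.sat (p.sol S)) :
    p.sol S' = p.sol S :=
  Optimal.eq_sol ⟨⟨(p.optimal_sol S).1.1, (p.optimal_sol S).1.2.1, h'⟩,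
    fun θ hθ => (p.optimal_sol S).2 θ (hθ.mono h)⟩

/-- A feasible point which is not the solution for fewer samples can be improved. -/
theorem sol_lt_of_ne {S : Set Δ} {θ : ℝ × E} (hθ : p.Feasible S θ) (hne : p.sol S ≠ θ) :
    (p.sol S).1 < θ.1 ∨ ((p.sol S).1 = θ.1 ∧ ‖(p.sol S).2‖ < ‖θ.2‖) := by
  rcases (p.optimal_sol S).2 θ hθ with h | ⟨h1, h2⟩
  · exact Or.inl h
  · refine Or.inr ⟨h1, lt_of_le_of_ne h2 fun h3 => hne (Optimal.eq_sol ⟨hθ, fun θ' hfeas => ?_⟩)⟩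
    rw [← h1, ← h3]
    exact (p.optimal_sol S).2 θ' hfeas

/-- A constraint which is inactive at the solution can be removed. -/
theorem sol_eq_of_inactive {S : Set Δ} (hS : S.Finite) {δ : Δ}
    (h : p.a δ (p.sol (insert δ S)).2 < (p.sol (insert δ S)).1 * p.b δ (p.sol (insert δ S)).2) :
    p.sol S = p.sol (insert δ S) := by
  by_contra hne
  set θ := p.sol (insert δ S) with hθdef
  have hopt : p.Optimal (insert δ S) θ := p.optimal_sol _
  have hfeas : p.Feasible S θ := hopt.1.mono (Set.subset_insert _ _)
  set θ' := p.sol S with hθ'def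
  have hθ' : p.Feasible S θ' := (p.optimal_sol S).1
  have hlt := sol_lt_of_ne hfeas hne
  have hle : θ'.1 ≤ θ.1 := by
    rcases hlt with h | h
    · exact h.le
    · exact h.1.le
  -- A short move from θ towards θ' keeps the constraint of δ strict.
  obtain ⟨s, hs0, hs1, hs⟩ : ∃ s : ℝ, 0 < s ∧ s < 1 ∧
      p.a δ ((1 - s) • θ.2 + s • θ'.2) < θ.1 * p.b δ ((1 - s) • θ.2 + s • θ'.2) := by
    have hc : Continuous fun s : ℝ => θ.1 * p.b δ ((1 - s) • θ.2 + s • θ'.2) -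
        p.a δ ((1 - s) • θ.2 + s • θ'.2) := by
      simp only [map_add, map_smul]; fun_prop
    have h0 : ∀ᶠ s in nhdsWithin (0 : ℝ) (Set.Ioi 0),
        0 < θ.1 * p.b δ ((1 - s) • θ.2 + s • θ'.2) - p.a δ ((1 - s) • θ.2 + s • θ'.2) := by
      refine nhdsWithin_le_nhds ((hc.tendsto 0).eventually (lt_mem_nhds ?_))
      simpa using h
    obtain ⟨s, hs, hs'⟩ := (h0.and (Ioo_mem_nhdsGT (zero_lt_one (α := ℝ)))).exists
    exact ⟨s, hs'.1, hs'.2, sub_pos.1 hs⟩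
  set Q := (1 - s) • θ.2 + s • θ'.2 with hQ
  have hb' : ∀ δ, 1 ≤ p.b δ θ'.2 := fun δ => p.one_le_b δ _ hθ'.2.1
  have hQX : Q ∈ p.X := p.convex_X hfeas.2.1 hθ'.2.1 (by linarith) hs0.le (by ring)
  -- If θ' has a lower level, all constraints are strict at Q for level `θ.1`, so the level can
  -- drop. Otherwise Q is feasible at that level with smaller norm. Both contradict the optimality
  -- of θ.
  rcases hlt with hlt | ⟨heq, hlt⟩
  · obtain ⟨t', ht', hf⟩ := exists_feasible_lt (hS.insert δ) (Set.insert_nonempty _ _) hQX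
      (t := θ.1) (by
        rintro δ' (rfl | hδ')
        · exact hs
        · have e1 := hfeas.2.2 δ' hδ'
          have e2 := hθ'.2.2 δ' hδ'
          have e3 := hb' δ'
          simp only [hQ, map_add, map_smul, smul_eq_mul]
          have e4 : p.a δ' θ'.2 < θ.1 * p.b δ' θ'.2 :=
            e2.trans_lt (mul_lt_mul_of_pos_right hlt (by linarith))
          nlinarith)
    rcases hopt.2 _ hf with h | h
    · exact absurd ht' (not_lt.2 h.le)
    · exact ht'.ne' h.1
  · have hf' : p.Feasible S (θ.1, θ'.2) := ⟨hfeas.1, hθ'.2.1, by rw [← heq]; exact hθ'.2.2⟩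
    have hf : p.Feasible (insert δ S) (θ.1, Q) := by
      refine ⟨hfeas.1, hQX, ?_⟩
      rintro δ' (rfl | hδ')
      · exact hs.le
      · exact (Feasible.convex_comb (P := θ.2) (Q := θ'.2) hfeas hf' (by linarith : 0 ≤ 1 - s)
          hs0.le (by ring)).2.2 δ' hδ'
    rcases hopt.2 _ hf with h | h
    · exact lt_irrefl _ h
    · have h1 : ‖Q‖ ≤ (1 - s) * ‖θ.2‖ + s * ‖θ'.2‖ := by
        refine (norm_add_le _ _).trans ?_
        rw [norm_smul, norm_smul, Real.norm_of_nonneg (by linarith : 0 ≤ 1 - s),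
          Real.norm_of_nonneg hs0.le]
      have h2 : ‖θ.2‖ ≤ ‖Q‖ := h.2
      nlinarith

end ScenarioProgram

/-! ### Helly's theorem: d constraints determine the solution -/

namespace ScenarioProgram

variable {Δ E : Type*} [TopologicalSpace Δ] [NormedAddCommGroup E] [InnerProductSpace ℝ E]
  (p : ScenarioProgram Δ E) [CompactSpace Δ]

/-- The solution of the program is determined by `finrank ℝ E` of the constraints. In the proof,
`v ↦ (p.T v, pt v)` parametrizes the pairs `(τ, Q)` with `p.T Q = 1`, and Helly's theorem is applied
to the half-spaces cut out by the constraints and the cone of improving directions. -/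
theorem exists_card_eq_sol_eq [FiniteDimensional ℝ E] {d : ℕ} (hdim : Module.finrank ℝ E ≤ d)
    (hd : 0 < d) {ι : Type*} [Fintype ι] (hι : d ≤ Fintype.card ι) (ω : ι → Δ) :
    ∃ I : Finset ι, I.card = d ∧ p.sol (ω '' I) = p.sol (Set.range ω) := by
  classical
  by_contra! hcon
  set θ := p.sol (Set.range ω) with hθ
  have hopt : p.Optimal (Set.range ω) θ := p.optimal_sol _
  have hne : Nonempty ι := Fintype.card_pos_iff.1 (hd.trans_le hι)
  obtain ⟨P₀, hP₀⟩ := p.nonempty_X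
  set e : E := (p.T P₀)⁻¹ • P₀ with he
  have hTe : p.T e = 1 := by
    simp [he, (p.T_pos P₀ hP₀).ne']
  -- Here `p.T (pt v) = 1` for every v. Normalising Q frees one dimension, which the slack τ = `p.T
  -- v` takes up, so Helly asks only for intersections of at most d + 1 sets.
  set pt : E → E := fun v => v + (1 - p.T v) • e with hpt
  have hpt_comb : ∀ (v w : E) (α β : ℝ), α + β = 1 →
      pt (α • v + β • w) = α • pt v + β • pt w := by
    intro v w α β h
    have h2 : (1 - (α * p.T v + β * p.T w)) = α * (1 - p.T v) + β * (1 - p.T w) := by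
      linear_combination -h
    simp only [hpt, map_add, map_smul, smul_eq_mul, h2]
    module
  have hpt_surj : ∀ Q ∈ p.X, ∀ τ : ℝ, ∃ v, p.T v = (p.T Q)⁻¹ * τ ∧ pt v = (p.T Q)⁻¹ • Q := by
    intro Q hQ τ
    have hT := (p.T_pos Q hQ).ne'
    have h1 : p.T ((p.T Q)⁻¹ • Q - (1 - (p.T Q)⁻¹ * τ) • e) = (p.T Q)⁻¹ * τ := by
      simp only [map_sub, map_smul, smul_eq_mul, hTe]
      field_simp
      ring
    refine ⟨_, h1, ?_⟩
    simp only [hpt, h1]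
    module
  -- The set at `none` holds the points that have positive slack, or zero slack and smaller norm;
  -- the factor r undoes the normalisation.
  let F : Option ι → Set E := fun o => match o with
    | none => {v | ∃ Q ∈ p.X, ∃ r : ℝ, 0 < r ∧ pt v = r • Q ∧
        (0 < p.T v ∨ (p.T v = 0 ∧ ‖Q‖ < ‖θ.2‖))}
    | some i => {v | p.a (ω i) (pt v) - θ.1 * p.b (ω i) (pt v) + p.T v ≤ 0}
  have hconv : ∀ o ∈ (Finset.univ : Finset (Option ι)), Convex ℝ (F o) := by
    rintro (_ | i) -
    · rw [convex_iff_forall_pos]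
      rintro v ⟨Q, hQ, r, hr, hv, hv'⟩ w ⟨R, hR, s, hs, hw, hw'⟩ α β hα hβ hαβ
      have hpos : 0 < α * r + β * s := by positivity
      have hsum : α * r / (α * r + β * s) + β * s / (α * r + β * s) = 1 := by
        field_simp
      refine ⟨(α * r / (α * r + β * s)) • Q + (β * s / (α * r + β * s)) • R,
        p.convex_X hQ hR (by positivity) (by positivity) hsum, α * r + β * s, hpos, ?_, ?_⟩
      · rw [hpt_comb _ _ _ _ hαβ, hv, hw, smul_add, smul_smul, smul_smul, smul_smul, smul_smul,
          mul_div_cancel₀ _ hpos.ne', mul_div_cancel₀ _ hpos.ne']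
      · simp only [map_add, map_smul, smul_eq_mul]
        rcases hv' with hv' | ⟨hv', hQn⟩
        · left
          have : 0 ≤ p.T w := by rcases hw' with h | h; exacts [h.le, h.1.ge]
          positivity
        · rcases hw' with hw' | ⟨hw', hRn⟩
          · left
            rw [hv']; simp only [mul_zero, zero_add]; positivity
          · right
            refine ⟨by simp [hv', hw'], ?_⟩
            refine (norm_add_le _ _).trans_lt ?_
            rw [norm_smul, norm_smul, Real.norm_of_nonneg (by positivity),
              Real.norm_of_nonneg (by positivity)]
            calc _ < α * r / (α * r + β * s) * ‖θ.2‖ + β * s / (α * r + β * s) * ‖θ.2‖ := by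
                  gcongr
              _ = ‖θ.2‖ := by rw [← add_mul, hsum, one_mul]
    · rw [convex_iff_forall_pos]
      intro v hv w hw α β hα hβ hαβ
      simp only [F, Set.mem_ofPred_eq] at hv hw ⊢
      rw [hpt_comb _ _ _ _ hαβ]
      simp only [map_add, map_smul, smul_eq_mul]
      nlinarith
  have hinter : ∀ J ⊆ (Finset.univ : Finset (Option ι)), J.card ≤ Module.finrank ℝ E + 1 →
      (⋂ o ∈ J, F o).Nonempty := by
    intro J _ hJ
    by_cases hnone : none ∈ J
    -- Besides `none` at most d constraints occur. Enlarged to exactly d, they have by assumption a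
    -- strictly better solution, which gives the common point.
    · have hJ' : J.eraseNone.card ≤ d := by
        have h1 : (J.erase none).card + 1 = J.card := Finset.card_erase_add_one hnone
        have h2 : J.eraseNone.card = (J.erase none).card := by
          rw [← Finset.map_some_eraseNone, Finset.card_map]
        omega
      obtain ⟨I, hJI, hI⟩ := Finset.exists_superset_card_eq hJ' hι
      have hθI : p.Feasible (ω '' I) θ := hopt.1.mono (Set.image_subset_range _ _)
      have hlt := sol_lt_of_ne hθI (hcon I hI)
      set θ' := p.sol (ω '' I)
      have hθ' : p.Feasible (ω '' I) θ' := (p.optimal_sol _).1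
      have hle : θ'.1 ≤ θ.1 := by rcases hlt with h | h; exacts [h.le, h.1.le]
      have hT := p.T_pos _ hθ'.2.1
      obtain ⟨v, hv1, hv2⟩ := hpt_surj θ'.2 hθ'.2.1 (θ.1 - θ'.1)
      refine ⟨v, Set.mem_iInter₂.2 ?_⟩
      rintro (_ | i) ho
      · refine ⟨θ'.2, hθ'.2.1, _, inv_pos.2 hT, hv2, ?_⟩
        rw [hv1]
        rcases hlt with h | h
        · left
          have : 0 < θ.1 - θ'.1 := sub_pos.2 h
          positivity
        · right
          exact ⟨by rw [h.1]; simp, h.2⟩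
      · have hiI : i ∈ I := hJI (by simpa using ho)
        have h1 := hθ'.2.2 (ω i) (Set.mem_image_of_mem ω hiI)
        have h2 := p.one_le_b (ω i) _ hθ'.2.1
        simp only [F, Set.mem_ofPred_eq, hv1, hv2, map_smul, smul_eq_mul]
        -- As b ≥ 1, lowering the level by `θ.1 - θ'.1` yields at least that much slack.
        have h3 : p.a (ω i) θ'.2 - θ.1 * p.b (ω i) θ'.2 + (θ.1 - θ'.1) ≤ 0 := by nlinarith
        have h4 : 0 < (p.T θ'.2)⁻¹ := inv_pos.2 hT
        nlinarith
    · obtain ⟨v, hv1, hv2⟩ := hpt_surj θ.2 hopt.1.2.1 0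
      refine ⟨v, Set.mem_iInter₂.2 ?_⟩
      rintro (_ | i) ho
      · exact absurd ho hnone
      · have h1 := hopt.1.2.2 (ω i) (Set.mem_range_self i)
        have h4 : 0 < (p.T θ.2)⁻¹ := inv_pos.2 (p.T_pos _ hopt.1.2.1)
        simp only [F, Set.mem_ofPred_eq, hv1, hv2, map_smul, smul_eq_mul]
        nlinarith
  obtain ⟨v, hv⟩ := Convex.helly_theorem' hconv hinter
  have hv : ∀ o, v ∈ F o := fun o => Set.mem_iInter₂.1 hv o (Finset.mem_univ o)
  obtain ⟨Q, hQ, r, hr, hvr, hv'⟩ := hv none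
  have hY : ∀ i, r * (p.a (ω i) Q - θ.1 * p.b (ω i) Q) + p.T v ≤ 0 := by
    intro i
    have := hv (some i)
    simp only [F, Set.mem_ofPred_eq, hvr, map_smul, smul_eq_mul] at this
    linarith
  -- Positive slack makes every constraint strict at Q, so the level can drop; zero slack leaves Q
  -- feasible with smaller norm. Either contradicts the optimality of θ.
  rcases hv' with hT | ⟨hT, hnorm⟩
  · obtain ⟨t', ht', hf⟩ := exists_feasible_lt (Set.finite_range ω) (Set.range_nonempty ω) hQ
      (t := θ.1) (by
        rintro _ ⟨i, rfl⟩
        by_contra! h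
        have := hY i
        nlinarith)
    rcases hopt.2 _ hf with h | h
    · exact absurd ht' (not_lt.2 h.le)
    · exact ht'.ne' h.1
  · have hf : p.Feasible (Set.range ω) (θ.1, Q) := by
      refine ⟨hopt.1.1, hQ, ?_⟩
      rintro _ ⟨i, rfl⟩
      by_contra! h
      have := hY i
      simp only at h
      nlinarith
    rcases hopt.2 _ hf with h | h
    · exact lt_irrefl _ h
    · exact absurd hnorm (not_lt.2 h.2)

end ScenarioProgram

/-! ### Measurability of the solution -/

namespace ScenarioProgram

variable {Δ E : Type*} [TopologicalSpace Δ] [NormedAddCommGroup E] [InnerProductSpace ℝ E]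
  (p : ScenarioProgram Δ E) {ι : Type*}

/-- Projection along the compact set `p.X` is a closed map. All measurability of the solution rests
on this. -/
theorem isClosed_exists_feasible {D : Set E} (hD : IsClosed D) :
    IsClosed {x : (ι → Δ) × ℝ × ℝ | ∃ P ∈ p.X, P ∈ D ∧ ‖P‖ ≤ x.2.2 ∧
      ∀ i, p.a (x.1 i) P ≤ x.2.1 * p.b (x.1 i) P} := by
  have : CompactSpace p.X := isCompact_iff_compactSpace.1 p.isCompact_X
  have hc : IsClosed {y : p.X × ((ι → Δ) × ℝ × ℝ) | (y.1 : E) ∈ D ∧ ‖(y.1 : E)‖ ≤ y.2.2.2 ∧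
      ∀ i, p.a (y.2.1 i) y.1 ≤ y.2.2.1 * p.b (y.2.1 i) y.1} := by
    have h1 : ∀ i, Continuous fun y : p.X × ((ι → Δ) × ℝ × ℝ) => (y.2.1 i, (y.1 : E)) :=
      fun i => by fun_prop
    have hsplit : {y : p.X × ((ι → Δ) × ℝ × ℝ) | (y.1 : E) ∈ D ∧ ‖(y.1 : E)‖ ≤ y.2.2.2 ∧
        ∀ i, p.a (y.2.1 i) y.1 ≤ y.2.2.1 * p.b (y.2.1 i) y.1} =
        {y | (y.1 : E) ∈ D} ∩ ({y | ‖(y.1 : E)‖ ≤ y.2.2.2} ∩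
          ⋂ i, {y | p.a (y.2.1 i) y.1 ≤ y.2.2.1 * p.b (y.2.1 i) y.1}) := by
      ext y; simp
    rw [hsplit]
    refine (hD.preimage (by fun_prop : Continuous fun y : p.X × ((ι → Δ) × ℝ × ℝ) =>
      (y.1 : E))).inter ((isClosed_le (by fun_prop) (by fun_prop)).inter
        (isClosed_iInter fun i => isClosed_le ?_ ?_))
    · exact p.continuous_a.comp (h1 i)
    · exact Continuous.mul (by fun_prop) (p.continuous_b.comp (h1 i))
  convert isClosedMap_snd_of_compactSpace _ hc using 1
  ext x
  constructor
  · rintro ⟨P, hP, h⟩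
    exact ⟨(⟨P, hP⟩, x), h, rfl⟩
  · rintro ⟨⟨P, x⟩, h, rfl⟩
    exact ⟨P, P.2, h⟩

variable [CompactSpace Δ]

/-- The vacuous conditions `P ∈ Set.univ` and `‖P‖ ≤ R` bring the right side into the form of
`isClosed_exists_feasible`. -/
theorem sol_fst_le_iff (ω : ι → Δ) {R : ℝ} (hR : ∀ P ∈ p.X, ‖P‖ ≤ R) (c : ℝ) :
    (p.sol (Set.range ω)).1 ≤ c ↔ 0 ≤ c ∧ ∃ P ∈ p.X, P ∈ Set.univ ∧ ‖P‖ ≤ R ∧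
      ∀ i, p.a (ω i) P ≤ c * p.b (ω i) P := by
  have hopt := p.optimal_sol (Set.range ω)
  constructor
  · intro h
    refine ⟨hopt.1.1.trans h, _, hopt.1.2.1, trivial, hR _ hopt.1.2.1, fun i => ?_⟩
    have h1 := hopt.1.2.2 (ω i) ⟨i, rfl⟩
    have h2 := p.one_le_b (ω i) _ hopt.1.2.1
    nlinarith
  · rintro ⟨hc, P, hP, -, -, h⟩
    have : p.Feasible (Set.range ω) (c, P) := ⟨hc, hP, by rintro _ ⟨i, rfl⟩; exact h i⟩
    rcases hopt.2 _ this with h | h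
    exacts [h.le, h.1.le]

theorem norm_sol_snd_le_iff (ω : ι → Δ) (r : ℝ) :
    ‖(p.sol (Set.range ω)).2‖ ≤ r ↔ ∃ P ∈ p.X, P ∈ Set.univ ∧ ‖P‖ ≤ r ∧
      ∀ i, p.a (ω i) P ≤ (p.sol (Set.range ω)).1 * p.b (ω i) P := by
  have hopt := p.optimal_sol (Set.range ω)
  constructor
  · intro h
    exact ⟨_, hopt.1.2.1, trivial, h, fun i => hopt.1.2.2 (ω i) ⟨i, rfl⟩⟩
  · rintro ⟨P, hP, -, hr, h⟩
    have : p.Feasible (Set.range ω) ((p.sol (Set.range ω)).1, P) :=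
      ⟨hopt.1.1, hP, by rintro _ ⟨i, rfl⟩; exact h i⟩
    rcases hopt.2 _ this with h | h
    exacts [absurd h (lt_irrefl _), h.2.trans hr]

/-- By uniqueness, a P feasible at the optimal level with norm at most the optimal one is the
solution itself. -/
theorem sol_snd_mem_iff (ω : ι → Δ) (D : Set E) :
    (p.sol (Set.range ω)).2 ∈ D ↔ ∃ P ∈ p.X, P ∈ D ∧ ‖P‖ ≤ ‖(p.sol (Set.range ω)).2‖ ∧
      ∀ i, p.a (ω i) P ≤ (p.sol (Set.range ω)).1 * p.b (ω i) P := by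
  have hopt := p.optimal_sol (Set.range ω)
  constructor
  · intro h
    exact ⟨_, hopt.1.2.1, h, le_rfl, fun i => hopt.1.2.2 (ω i) ⟨i, rfl⟩⟩
  · rintro ⟨P, hP, hD, hr, h⟩
    have hf : p.Feasible (Set.range ω) ((p.sol (Set.range ω)).1, P) :=
      ⟨hopt.1.1, hP, by rintro _ ⟨i, rfl⟩; exact h i⟩
    by_contra hne
    have hne' : p.sol (Set.range ω) ≠ ((p.sol (Set.range ω)).1, P) := by
      intro h'
      rw [h'] at hne
      exact hne hD
    rcases sol_lt_of_ne hf hne' with h | h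
    exacts [lt_irrefl _ h, absurd h.2 (not_lt.2 hr)]

variable [MeasurableSpace Δ] [BorelSpace Δ] [SecondCountableTopology Δ] [MeasurableSpace E]
  [BorelSpace E] [Finite ι]

/-- Level, norm and P are treated in this order, each being described by a closed condition in terms
of the preceding ones. -/
theorem measurable_sol_range : Measurable fun ω : ι → Δ => p.sol (Set.range ω) := by
  cases nonempty_fintype ι
  obtain ⟨R, hR⟩ := p.isCompact_X.isBounded.exists_norm_le
  have hZ := (p.isClosed_exists_feasible (ι := ι) isClosed_univ).measurableSet
  have h1 : Measurable fun ω : ι → Δ => (p.sol (Set.range ω)).1 := by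
    refine measurable_of_Iic fun c => ?_
    have hm : Measurable fun ω : ι → Δ => (ω, c, R) := by fun_prop
    by_cases hc : 0 ≤ c
    · convert hm hZ using 1
      ext ω
      simpa [hc] using p.sol_fst_le_iff ω hR c
    · convert MeasurableSet.empty using 1
      ext ω
      simpa [hc] using p.sol_fst_le_iff ω hR c
  have h2 : Measurable fun ω : ι → Δ => ‖(p.sol (Set.range ω)).2‖ := by
    refine measurable_of_Iic fun r => ?_
    have hm : Measurable fun ω : ι → Δ => (ω, (p.sol (Set.range ω)).1, r) := by fun_prop
    convert hm hZ using 1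
    ext ω
    exact p.norm_sol_snd_le_iff ω r
  have h3 : Measurable fun ω : ι → Δ => (p.sol (Set.range ω)).2 := by
    refine measurable_of_isClosed fun D hD => ?_
    have hm : Measurable fun ω : ι → Δ =>
      (ω, (p.sol (Set.range ω)).1, ‖(p.sol (Set.range ω)).2‖) := by fun_prop
    convert hm (p.isClosed_exists_feasible (ι := ι) hD).measurableSet using 1
    ext ω
    exact p.sol_snd_mem_iff ω D
  exact h1.prodMk h3

theorem measurable_sol_image (I : Set ι) : Measurable fun ω : ι → Δ => p.sol (ω '' I) := by
  have h : Measurable fun ω : ι → Δ => fun i : I => ω i := by fun_prop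
  convert (p.measurable_sol_range (ι := I)).comp h using 1
  funext ω
  simp only [Function.comp, Set.image_eq_range]

end ScenarioProgram

/-! ### Bases and the distribution of the confidence -/

namespace ScenarioProgram

variable {Δ E : Type*} [TopologicalSpace Δ] [NormedAddCommGroup E] [InnerProductSpace ℝ E]
  (p : ScenarioProgram Δ E) {ι : Type*}

/-- The samples whose constraint holds with equality at `θ`. -/
def active (θ : ℝ × E) : Set Δ := {δ | p.a δ θ.2 = θ.1 * p.b δ θ.2}

section

variable [MeasurableSpace Δ] [BorelSpace Δ] [SecondCountableTopology Δ] [MeasurableSpace E]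
  [BorelSpace E] [SecondCountableTopology E]

theorem measurableSet_sat : MeasurableSet {x : (ℝ × E) × Δ | x.2 ∈ p.sat x.1} := by
  have h : Continuous fun x : (ℝ × E) × Δ => (x.2, x.1.2) := by fun_prop
  exact (isClosed_le (p.continuous_a.comp h)
    ((by fun_prop : Continuous fun x : (ℝ × E) × Δ => x.1.1).mul
      (p.continuous_b.comp h))).measurableSet

theorem measurableSet_active : MeasurableSet {x : (ℝ × E) × Δ | x.2 ∈ p.active x.1} := by
  have h : Continuous fun x : (ℝ × E) × Δ => (x.2, x.1.2) := by fun_prop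
  exact (isClosed_eq (p.continuous_a.comp h)
    ((by fun_prop : Continuous fun x : (ℝ × E) × Δ => x.1.1).mul
      (p.continuous_b.comp h))).measurableSet

/-- The probability that a new sample is compatible with `θ`. -/
def conf (π : Measure Δ) (θ : ℝ × E) : ℝ := π.real (p.sat θ)

theorem measurable_conf (π : Measure Δ) [IsProbabilityMeasure π] : Measurable (p.conf π) :=
  (measurable_measure_prodMk_left p.measurableSet_sat).ennreal_toReal

end

variable [CompactSpace Δ]

/-- No constraint can be removed without changing the solution. -/
def SelfBasis (ω : ι → Δ) : Prop := ∀ i, p.sol (ω '' {i}ᶜ) ≠ p.sol (Set.range ω)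

/-- `I` is a minimal set of constraints which determines the solution. -/
def IsBasis (ω : ι → Δ) (I : Finset ι) : Prop :=
  p.sol (ω '' I) = p.sol (Set.range ω) ∧ ∀ i ∈ I, p.sol (ω '' (I \ {i})) ≠ p.sol (ω '' I)

variable {p}

/-- This separates a condition on the samples in I from one condition on each remaining sample, the
form needed for Fubini. -/
theorem isBasis_iff {ω : ι → Δ} {I : Finset ι} :
    p.IsBasis ω I ↔ p.SelfBasis (fun i : {i // i ∈ I} => ω i) ∧
      ∀ j : {j // j ∉ I}, ω j ∈ p.sat (p.sol (Set.range fun i : {i // i ∈ I} => ω i)) := by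
  have h1 : Set.range (fun i : {i // i ∈ I} => ω i) = ω '' I := by
    ext x; simp
  have h2 : ∀ i : {i // i ∈ I}, (fun i : {i // i ∈ I} => ω i) '' {i}ᶜ = ω '' (I \ {i.1}) := by
    rintro ⟨i, hi⟩
    ext x
    simp only [Set.mem_image, Set.mem_compl_iff, Set.mem_singleton_iff, Subtype.exists,
      Set.mem_sdiff, Finset.mem_coe, Subtype.mk.injEq]
    constructor
    · rintro ⟨a, ha, hne, rfl⟩; exact ⟨a, ⟨ha, hne⟩, rfl⟩
    · rintro ⟨a, ⟨ha, hne⟩, rfl⟩; exact ⟨a, ha, hne, rfl⟩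
  unfold IsBasis SelfBasis
  rw [h1]
  simp only [h2, Subtype.forall]
  rw [and_comm]
  refine and_congr_right fun _ => ⟨fun h j _ => ?_, fun h => ?_⟩
  · rw [h]; exact subset_sat_sol _ ⟨j, rfl⟩
  · refine (sol_eq_of_subset_sat (Set.image_subset_range _ _) ?_).symm
    rintro _ ⟨j, rfl⟩
    by_cases hj : j ∈ I
    · exact subset_sat_sol _ ⟨j, hj, rfl⟩
    · exact h j hj

theorem exists_isBasis [FiniteDimensional ℝ E] {d : ℕ} (hdim : Module.finrank ℝ E ≤ d)
    (hd : 0 < d) [Fintype ι] (hι : d ≤ Fintype.card ι) (ω : ι → Δ) :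
    ∃ I : Finset ι, I.card ≤ d ∧ p.IsBasis ω I := by
  classical
  obtain ⟨I₀, hI₀, hsol⟩ := p.exists_card_eq_sol_eq hdim hd hι ω
  obtain ⟨I, hI, hmin⟩ := (Finset.univ.filter fun I : Finset ι => I.card ≤ d ∧
    p.sol (ω '' I) = p.sol (Set.range ω)).exists_min_image Finset.card
      ⟨I₀, by simp [hI₀, hsol]⟩
  simp only [Finset.mem_filter, Finset.mem_univ, true_and] at hI hmin
  refine ⟨I, hI.1, hI.2, fun i hi h => ?_⟩
  have h1 : (I.erase i).card < I.card := Finset.card_erase_lt_of_mem hi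
  have h2 := hmin (I.erase i) ⟨by omega, by rw [Finset.coe_erase, h, hI.2]⟩
  omega

/-- An element of I outside J would be inactive at the common solution, hence removable from I,
against minimality. -/
theorem IsBasis.subset {ω : ι → Δ} {I J : Finset ι} (hI : p.IsBasis ω I) (hJ : p.IsBasis ω J)
    (h : ∀ i ∉ J, ω i ∉ p.active (p.sol (ω '' J))) : I ⊆ J := by
  classical
  intro i hi
  by_contra hiJ
  have hins : insert (ω i) (ω '' ((I : Set ι) \ {i})) = ω '' I := by
    rw [← Set.image_insert_eq, Set.insert_sdiff_singleton, Set.insert_eq_of_mem (by simpa using hi)]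
  refine hI.2 i hi ?_
  rw [sol_eq_of_inactive (δ := ω i) ((I.finite_toSet.sdiff).image _), hins]
  rw [hins, hI.1, ← hJ.1]
  refine lt_of_le_of_ne ?_ (h i hiJ)
  rw [hJ.1]
  exact subset_sat_sol _ ⟨i, rfl⟩

section Measure

variable [MeasurableSpace Δ] [BorelSpace Δ] [SecondCountableTopology Δ] [MeasurableSpace E]
  [BorelSpace E] [SecondCountableTopology E] (π : Measure Δ) [IsProbabilityMeasure π]

theorem measurableSet_selfBasis [Finite ι] : MeasurableSet {ω : ι → Δ | p.SelfBasis ω} := by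
  simp only [SelfBasis, Set.ofPred_forall]
  refine MeasurableSet.iInter fun i => ?_
  exact (measurableSet_eq_fun (p.measurable_sol_image _) p.measurable_sol_range).compl

theorem measurableSet_isBasis [Finite ι] (I : Finset ι) :
    MeasurableSet {ω : ι → Δ | p.IsBasis ω I} := by
  simp only [IsBasis, Set.ofPred_and, Set.ofPred_forall]
  refine (measurableSet_eq_fun (p.measurable_sol_image _) p.measurable_sol_range).inter ?_
  refine MeasurableSet.iInter fun i => MeasurableSet.iInter fun _ => ?_
  exact (measurableSet_eq_fun (p.measurable_sol_image _) (p.measurable_sol_image _)).compl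

variable (p ι) in
/-- The law of the confidence of the solution, on the event that no constraint is redundant. -/
def confLaw [Fintype ι] : Measure ℝ :=
  ((Measure.pi fun _ : ι => π).restrict {u | p.SelfBasis u}).map
    fun u => p.conf π (p.sol (Set.range u))

theorem measurable_conf_sol [Finite ι] :
    Measurable fun u : ι → Δ => p.conf π (p.sol (Set.range u)) :=
  (p.measurable_conf π).comp p.measurable_sol_range

instance [Fintype ι] : IsFiniteMeasure (p.confLaw ι π) := by
  unfold confLaw; infer_instance

theorem ae_confLaw_mem_Icc [Fintype ι] : ∀ᵐ y ∂p.confLaw ι π, y ∈ Set.Icc (0 : ℝ) 1 := by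
  unfold confLaw
  refine (ae_map_iff (p := fun y => y ∈ Set.Icc (0 : ℝ) 1) (measurable_conf_sol π).aemeasurable
    measurableSet_Icc).2 ?_
  exact Filter.Eventually.of_forall fun u => ⟨measureReal_nonneg, measureReal_le_one⟩

theorem confLaw_congr {κ : Type*} [Fintype ι] [Fintype κ] (e : κ ≃ ι) :
    p.confLaw κ π = p.confLaw ι π := by
  have hmp := measurePreserving_piCongrLeft (fun _ : ι => π) e
  set f := MeasurableEquiv.piCongrLeft (fun _ : ι => Δ) e with hf
  have hfe : ∀ (u : κ → Δ) (k : κ), f u (e k) = u k := fun u k =>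
    Equiv.piCongrLeft_apply_apply (fun _ : ι => Δ) e u k
  have hrange : ∀ u : κ → Δ, Set.range (f u) = Set.range u := by
    intro u
    have : f u ∘ e = u := funext (hfe u)
    rw [← e.surjective.range_comp, this]
  have himage : ∀ (u : κ → Δ) (k : κ), f u '' {e k}ᶜ = u '' {k}ᶜ := by
    intro u k
    have h1 : f u ∘ e = u := funext (hfe u)
    conv_rhs => rw [← h1, Set.image_comp, Set.image_compl_eq e.bijective, Set.image_singleton]
  have hself : ∀ u : κ → Δ, p.SelfBasis (f u) ↔ p.SelfBasis u := by
    intro u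
    unfold SelfBasis
    rw [← e.forall_congr_right]
    simp only [himage, hrange]
  unfold confLaw
  have h2 := hmp.restrict_preimage (measurableSet_selfBasis (p := p) (ι := ι))
  rw [← h2.map_eq, Measure.map_map (measurable_conf_sol π) f.measurable]
  have h3 : f ⁻¹' {u | p.SelfBasis u} = {u | p.SelfBasis u} := by
    ext u; exact hself u
  have h4 : (fun u : ι → Δ => p.conf π (p.sol (Set.range u))) ∘ f =
      fun u => p.conf π (p.sol (Set.range u)) := by
    funext u; simp only [Function.comp, hrange]
  rw [h3, h4]

/-- Given the samples in I, each of the others is independently compatible with probability equal to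
the confidence y; this produces the power of y. -/
theorem measure_isBasis_inter [Fintype ι] (I : Finset ι) {D : Set ℝ} (hD : MeasurableSet D) :
    (Measure.pi fun _ : ι => π)
      {ω | p.IsBasis ω I ∧ p.conf π (p.sol (Set.range ω)) ∈ D} =
      ∫⁻ y in D, ENNReal.ofReal y ^ (Fintype.card ι - I.card) ∂p.confLaw (Fin I.card) π := by
  classical
  let _ : Fintype {i // i ∈ I} := Subtype.fintype (· ∈ I)
  rw [confLaw_congr π (I.equivFin.symm)]
  have hmp := measurePreserving_piEquivPiSubtypeProd (fun _ : ι => π) (· ∈ I)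
  set B : Set (({i // i ∈ I} → Δ) × ({i // i ∉ I} → Δ)) :=
    {x | (p.SelfBasis x.1 ∧ p.conf π (p.sol (Set.range x.1)) ∈ D) ∧
      ∀ j, x.2 j ∈ p.sat (p.sol (Set.range x.1))} with hB
  have hA : MeasurableSet {u : {i // i ∈ I} → Δ |
      p.SelfBasis u ∧ p.conf π (p.sol (Set.range u)) ∈ D} :=
    measurableSet_selfBasis.inter (measurable_conf_sol π hD)
  have hBm : MeasurableSet B := by
    rw [hB]
    simp only [Set.ofPred_and, Set.ofPred_forall]
    refine (measurable_fst hA).inter (MeasurableSet.iInter fun j => ?_)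
    have hm : Measurable fun x : ({i // i ∈ I} → Δ) × ({i // i ∉ I} → Δ) =>
        (p.sol (Set.range x.1), x.2 j) :=
      (p.measurable_sol_range.comp measurable_fst).prodMk (by fun_prop)
    exact hm p.measurableSet_sat
  have hpre : {ω | p.IsBasis ω I ∧ p.conf π (p.sol (Set.range ω)) ∈ D} =
      MeasurableEquiv.piEquivPiSubtypeProd (fun _ : ι => Δ) (· ∈ I) ⁻¹' B := by
    ext ω
    have hsol : p.IsBasis ω I →
        p.sol (Set.range fun i : {i // i ∈ I} => ω i) = p.sol (Set.range ω) := by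
      intro h
      have h1 : Set.range (fun i : {i // i ∈ I} => ω i) = ω '' I := by ext x; simp
      rw [h1, h.1]
    change _ ↔ (p.SelfBasis (fun i : {i // i ∈ I} => ω i) ∧
      p.conf π (p.sol (Set.range fun i : {i // i ∈ I} => ω i)) ∈ D) ∧
      ∀ j : {j // j ∉ I}, ω j ∈ p.sat (p.sol (Set.range fun i : {i // i ∈ I} => ω i))
    constructor
    · rintro ⟨h1, h2⟩
      have h3 := isBasis_iff.1 h1
      exact ⟨⟨h3.1, by rw [hsol h1]; exact h2⟩, h3.2⟩
    · rintro ⟨⟨h1, h2⟩, h3⟩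
      have h4 : p.IsBasis ω I := isBasis_iff.2 ⟨h1, h3⟩
      exact ⟨h4, by rw [← hsol h4]; exact h2⟩
  rw [hpre, hmp.measure_preimage hBm.nullMeasurableSet, Measure.prod_apply hBm]
  unfold confLaw
  rw [Measure.restrict_map (measurable_conf_sol π) hD,
    lintegral_map (by fun_prop) (measurable_conf_sol π),
    Measure.restrict_restrict (measurable_conf_sol π hD), ← lintegral_indicator
      ((measurable_conf_sol π hD).inter measurableSet_selfBasis)]
  refine lintegral_congr fun u => ?_
  by_cases hu : p.SelfBasis u ∧ p.conf π (p.sol (Set.range u)) ∈ D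
  · rw [Set.indicator_of_mem (by exact ⟨hu.2, hu.1⟩)]
    have : Prod.mk u ⁻¹' B = Set.univ.pi fun _ => p.sat (p.sol (Set.range u)) := by
      ext v
      simp [hB, hu]
    rw [this, Measure.pi_pi]
    simp only [conf, Finset.prod_const, Finset.card_univ]
    rw [ofReal_measureReal, Fintype.card_subtype_compl,
      Fintype.card_of_subtype I fun _ => Iff.rfl]
  · rw [Set.indicator_of_notMem (fun h => hu ⟨h.2, h.1⟩)]
    have : Prod.mk u ⁻¹' B = ∅ := by
      ext v
      simp only [hB, Set.mem_preimage, Set.mem_ofPred_eq, Set.mem_empty_iff_false, iff_false]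
      exact fun h => hu h.1
    rw [this, measure_empty]

/-- Almost surely, no constraint is active at the solution for other samples. -/
theorem ae_not_active [Fintype ι]
    (hnull : ∀ θ : ℝ × E, 0 ≤ θ.1 → θ.2 ∈ p.X → π (p.active θ) = 0) :
    ∀ᵐ ω ∂(Measure.pi fun _ : ι => π),
      ∀ I : Finset ι, ∀ i ∉ I, ω i ∉ p.active (p.sol (ω '' I)) := by
  classical
  refine ae_all_iff.2 fun I => ae_all_iff.2 fun i => ?_
  by_cases hi : i ∈ I
  · simp [hi]
  simp only [hi, not_false_eq_true, forall_const]
  have hmp := measurePreserving_piEquivPiSubtypeProd (fun _ : ι => π) (· ∈ I)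
  set B : Set (({i // i ∈ I} → Δ) × ({i // i ∉ I} → Δ)) :=
    {x | x.2 ⟨i, hi⟩ ∈ p.active (p.sol (Set.range x.1))} with hB
  have hBm : MeasurableSet B := by
    have hm : Measurable fun x : ({i // i ∈ I} → Δ) × ({i // i ∉ I} → Δ) =>
        (p.sol (Set.range x.1), x.2 ⟨i, hi⟩) :=
      (p.measurable_sol_range.comp measurable_fst).prodMk (by fun_prop)
    exact hm p.measurableSet_active
  have hpre : {ω | ¬ ω i ∉ p.active (p.sol (ω '' I))} =
      MeasurableEquiv.piEquivPiSubtypeProd (fun _ : ι => Δ) (· ∈ I) ⁻¹' B := by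
    ext ω
    have h1 : Set.range (fun i : {i // i ∈ I} => ω i) = ω '' I := by ext x; simp
    change _ ↔ ω i ∈ p.active (p.sol (Set.range fun i : {i // i ∈ I} => ω i))
    rw [h1]
    simp
  -- Once the coordinates in I are fixed so is the solution, while coordinate i still has law π.
  rw [ae_iff, hpre, hmp.measure_preimage hBm.nullMeasurableSet, Measure.measure_prod_null hBm]
  refine Filter.Eventually.of_forall fun u => ?_
  have hopt := p.optimal_sol (Set.range u)
  have hev := measurePreserving_eval (fun _ : {i // i ∉ I} => π) ⟨i, hi⟩
  have hact : MeasurableSet (p.active (p.sol (Set.range u))) :=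
    measurable_prodMk_left p.measurableSet_active
  exact (hev.measure_preimage hact.nullMeasurableSet).trans (hnull _ hopt.1.1 hopt.1.2.1)

/-- The events that I is a basis cover everything as I ranges over sets of size at most d, and are
almost surely disjoint by `IsBasis.subset`. By symmetry their measure depends only on the size of I.
-/
theorem measure_conf_mem [FiniteDimensional ℝ E] {d : ℕ} (hdim : Module.finrank ℝ E ≤ d)
    (hd : 0 < d) (hnull : ∀ θ : ℝ × E, 0 ≤ θ.1 → θ.2 ∈ p.X → π (p.active θ) = 0)
    {m : ℕ} (hm : d ≤ m) {D : Set ℝ} (hD : MeasurableSet D) :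
    (Measure.pi fun _ : Fin m => π) {ω | p.conf π (p.sol (Set.range ω)) ∈ D} =
      ∑ k ∈ Finset.range (d + 1), (m.choose k : ENNReal) *
        ∫⁻ y in D, ENNReal.ofReal y ^ (m - k) ∂p.confLaw (Fin k) π := by
  classical
  set μ := Measure.pi fun _ : Fin m => π
  set B : Finset (Fin m) → Set (Fin m → Δ) := fun I =>
    {ω | p.IsBasis ω I ∧ p.conf π (p.sol (Set.range ω)) ∈ D} with hB
  set s : Finset (Finset (Fin m)) := Finset.univ.powerset.filter fun I => I.card ≤ d with hs
  have hBm : ∀ I, MeasurableSet (B I) := fun I =>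
    (measurableSet_isBasis I).inter (measurable_conf_sol π hD)
  have hnd := ae_not_active (ι := Fin m) π hnull
  have hunion : {ω | p.conf π (p.sol (Set.range ω)) ∈ D} = ⋃ I ∈ s, B I := by
    ext ω
    simp only [Set.mem_iUnion]
    constructor
    · intro h
      obtain ⟨I, hI, hbas⟩ := exists_isBasis (p := p) hdim hd (by simpa using hm) ω
      exact ⟨I, by simp [hs, hI], hbas, h⟩
    · rintro ⟨I, -, h⟩
      exact h.2
  have hdisj : Set.Pairwise (s : Set (Finset (Fin m))) (Function.onFun (AEDisjoint μ) B) := by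
    intro I _ J _ hIJ
    refine measure_mono_null ?_ (ae_iff.1 hnd)
    rintro ω ⟨hI, hJ⟩ hω
    exact hIJ ((hI.1.subset hJ.1 (hω J)).antisymm (hJ.1.subset hI.1 (hω I)))
  rw [hunion, measure_biUnion_finset₀ hdisj fun I _ => (hBm I).nullMeasurableSet]
  have hterm : ∀ I ∈ s, μ (B I) = (fun k => ∫⁻ y in D, ENNReal.ofReal y ^ (m - k)
      ∂p.confLaw (Fin k) π) I.card := fun I _ => by
    simp only [hB, μ, measure_isBasis_inter π I hD, Fintype.card_fin]
  rw [Finset.sum_congr rfl hterm, hs, Finset.sum_filter,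
    Finset.sum_powerset_apply_card (fun k => if k ≤ d then ∫⁻ y in D, ENNReal.ofReal y ^ (m - k)
      ∂p.confLaw (Fin k) π else 0)]
  symm
  refine Finset.sum_subset_zero_on_sdiff (by simpa using hm) ?_ ?_
  · intro k hk
    simp only [Finset.mem_sdiff, Finset.mem_range] at hk
    rw [if_neg (by omega), smul_zero]
  · intro k hk
    simp only [Finset.mem_range] at hk
    rw [if_pos (by omega), nsmul_eq_mul, Finset.card_univ, Fintype.card_fin]

theorem setIntegral_pow_eq [Fintype ι] (j : ℕ) (D : Set ℝ) :
    ∫⁻ y in D, ENNReal.ofReal y ^ j ∂p.confLaw ι π =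
      ENNReal.ofReal (∫ y in D, y ^ j ∂p.confLaw ι π) := by
  have hae := ae_restrict_of_ae (s := D) (ae_confLaw_mem_Icc (p := p) (ι := ι) π)
  rw [ofReal_integral_eq_lintegral_ofReal
    (integrable_of_ae_mem_Icc (ae_confLaw_mem_Icc π) (by fun_prop)).integrableOn
    (hae.mono fun y hy => pow_nonneg hy.1 j)]
  refine lintegral_congr_ae (hae.mono fun y hy => ?_)
  simp only [ENNReal.ofReal_pow hy.1]

theorem sum_choose_mul_eq {d m : ℕ} (D : Set ℝ) :
    ∑ k ∈ Finset.range (d + 1), (m.choose k : ENNReal) *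
        ∫⁻ y in D, ENNReal.ofReal y ^ (m - k) ∂p.confLaw (Fin k) π =
      ENNReal.ofReal (∑ k ∈ Finset.range (d + 1), (m.choose k : ℝ) *
        ∫ y in D, y ^ (m - k) ∂p.confLaw (Fin k) π) := by
  have h0 : ∀ k, 0 ≤ ∫ y in D, y ^ (m - k) ∂p.confLaw (Fin k) π := fun k =>
    integral_nonneg_of_ae ((ae_restrict_of_ae (ae_confLaw_mem_Icc π)).mono
      fun y hy => pow_nonneg hy.1 _)
  rw [ENNReal.ofReal_sum_of_nonneg fun k _ => mul_nonneg (Nat.cast_nonneg _) (h0 k)]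
  refine Finset.sum_congr rfl fun k _ => ?_
  rw [setIntegral_pow_eq, ENNReal.ofReal_mul (Nat.cast_nonneg _), ENNReal.ofReal_natCast]

/-- The distribution of the confidence of the solution is dominated by a beta distribution. -/
theorem measure_conf_lt_le [FiniteDimensional ℝ E] {d : ℕ} (hdim : Module.finrank ℝ E ≤ d)
    (hd : 0 < d) (hnull : ∀ θ : ℝ × E, 0 ≤ θ.1 → θ.2 ∈ p.X → π (p.active θ) = 0)
    {N : ℕ} (hN : d ≤ N) {x : ℝ} (hx0 : 0 < x) (hx1 : x ≤ 1) :
    (Measure.pi fun _ : Fin N => π) {ω | p.conf π (p.sol (Set.range ω)) < 1 - x} ≤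
      ENNReal.ofReal (1 - regIncBeta d ((N : ℝ) - d + 1) x) := by
  have h1 := measure_conf_mem π hdim hd hnull hN (measurableSet_Iio (a := 1 - x))
  simp only [Set.mem_Iio] at h1
  rw [h1, sum_choose_mul_eq]
  refine ENNReal.ofReal_le_ofReal (sum_setIntegral_le_one_sub_regIncBeta hd hN
    (fun k => ae_confLaw_mem_Icc π) (fun m hm => ?_) hx0 hx1)
  -- Total mass one, for every m ≥ d, provides the moment identities.
  have h2 := measure_conf_mem π hdim hd hnull hm MeasurableSet.univ
  rw [sum_choose_mul_eq] at h2
  simp only [Set.mem_univ, Set.ofPred_true, measure_univ, Measure.restrict_univ] at h2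
  exact (ENNReal.ofReal_eq_one.1 h2.symm)

end Measure

end ScenarioProgram

/-! ### Quadratic norms and null level sets -/

section Quadratic

variable {n : ℕ} {P : Matrix (Fin n) (Fin n) ℝ}

theorem isHermitian_of_sub_one (h : (P - 1).PosSemidef) : P.IsHermitian := by
  simpa using h.1.add isHermitian_one

theorem quadForm_nonneg (h : P.PosSemidef) (v : Fin n → ℝ) : 0 ≤ v ⬝ᵥ P *ᵥ v := by
  simpa using h.dotProduct_mulVec_nonneg v

theorem dotProduct_self_le (h : (P - 1).PosSemidef) (v : Fin n → ℝ) :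
    v ⬝ᵥ v ≤ v ⬝ᵥ P *ᵥ v := by
  have := quadForm_nonneg h v
  simpa [sub_mulVec, dotProduct_sub] using this

theorem posSemidef_of_sub_one (h : (P - 1).PosSemidef) : P.PosSemidef := by
  simpa using h.add PosSemidef.one

theorem spectrum_finite (hP : P.IsHermitian) : (spectrum ℝ P).Finite := by
  rw [hP.spectrum_real_eq_range_eigenvalues]; exact Set.finite_range _

theorem eigMin_mul_le (hP : P.IsHermitian) (v : Fin n → ℝ) :
    eigMin P * (v ⬝ᵥ v) ≤ v ⬝ᵥ P *ᵥ v := by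
  have h : (P - algebraMap ℝ _ (eigMin P)).PosSemidef := by
    rw [posSemidef_iff_isHermitian_and_spectrum_nonneg]
    refine ⟨hP.sub ?_, ?_⟩
    · rw [Algebra.algebraMap_eq_smul_one]; exact isHermitian_one.smul (star_trivial _)
    · rw [← spectrum.sub_singleton_eq, Set.sub_singleton]
      rintro _ ⟨a, ha, rfl⟩
      exact sub_nonneg.2 (csInf_le (spectrum_finite hP).bddBelow ha)
  have := quadForm_nonneg h v
  rw [Algebra.algebraMap_eq_smul_one, sub_mulVec, smul_mulVec, one_mulVec, dotProduct_sub,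
    dotProduct_smul, smul_eq_mul] at this
  linarith

theorem le_eigMax_mul (hP : P.IsHermitian) (v : Fin n → ℝ) :
    v ⬝ᵥ P *ᵥ v ≤ eigMax P * (v ⬝ᵥ v) := by
  have h : (algebraMap ℝ _ (eigMax P) - P).PosSemidef := by
    rw [posSemidef_iff_isHermitian_and_spectrum_nonneg]
    refine ⟨IsHermitian.sub ?_ hP, ?_⟩
    · rw [Algebra.algebraMap_eq_smul_one]; exact isHermitian_one.smul (star_trivial _)
    · rw [← spectrum.singleton_sub_eq, Set.singleton_sub]
      rintro _ ⟨a, ha, rfl⟩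
      exact sub_nonneg.2 (le_csSup (spectrum_finite hP).bddAbove ha)
  have := quadForm_nonneg h v
  rw [Algebra.algebraMap_eq_smul_one, sub_mulVec, smul_mulVec, one_mulVec, dotProduct_sub,
    dotProduct_smul, smul_eq_mul] at this
  linarith

theorem one_le_eigMin (hn : 0 < n) (h : (P - 1).PosSemidef) : 1 ≤ eigMin P := by
  have hP := isHermitian_of_sub_one h
  -- The spectrum is non-empty because n > 0; for an empty spectrum `sInf` would be 0.
  refine le_csInf ?_ fun a ha => ?_
  · rw [hP.spectrum_real_eq_range_eigenvalues]
    exact ⟨_, ⟨⟨0, hn⟩, rfl⟩⟩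
  · have h2 := (posSemidef_iff_isHermitian_and_spectrum_nonneg.1 h).2
    have h3 : a - 1 ∈ spectrum ℝ (P - 1) := by
      have := spectrum.sub_singleton_eq P (1 : ℝ)
      rw [map_one] at this
      rw [← this, Set.sub_singleton]
      exact ⟨a, ha, rfl⟩
    have : 0 ≤ a - 1 := h2 h3
    linarith

theorem dotProduct_self_eq_norm_sq (v : EuclideanSpace ℝ (Fin n)) :
    v.ofLp ⬝ᵥ v.ofLp = ‖v‖ ^ 2 := by
  rw [EuclideanSpace.real_norm_sq_eq]
  simp [dotProduct, sq]

open scoped MatrixOrder Matrix.Norms.L2Operator in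
-- Writing P = BᵀB makes this the Euclidean triangle inequality for B u and B v.
theorem quadNorm_add_le (h : P.PosSemidef) (u v : Fin n → ℝ) :
    quadNorm P (u + v) ≤ quadNorm P u + quadNorm P v := by
  obtain ⟨B, rfl⟩ := CStarAlgebra.nonneg_iff_eq_star_mul_self.1 h.nonneg
  have key : ∀ w, quadNorm (star B * B) w = ‖WithLp.toLp 2 (B *ᵥ w)‖ := by
    intro w
    rw [quadNorm, ← Real.sqrt_sq (norm_nonneg (WithLp.toLp 2 (B *ᵥ w))),
      ← dotProduct_self_eq_norm_sq, ← mulVec_mulVec, dotProduct_mulVec, star_eq_conjTranspose,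
      conjTranspose_eq_transpose_of_trivial, vecMul_transpose]
  rw [key, key, key, mulVec_add, WithLp.toLp_add]
  exact norm_add_le _ _

theorem quadNorm_neg (v : Fin n → ℝ) : quadNorm P (-v) = quadNorm P v := by
  simp [quadNorm, mulVec_neg]

/-- A violation of the noise-corrected rate entails a violation of the noisy constraint. -/
theorem quadNorm_add_gt (hn : 0 < n) (h : (P - 1).PosSemidef) {l : ℕ} {W lam : ℝ} (hW : 0 ≤ W)
    {x w : EuclideanSpace ℝ (Fin n)} (hx : ‖x‖ = 1) (hw : ‖w‖ ≤ W) {u : Fin n → ℝ}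
    (hu : lamBar l W lam P * quadNorm P x.ofLp < quadNorm P u) :
    lam ^ l * quadNorm P x.ofLp < quadNorm P (u + w.ofLp) := by
  have hP := isHermitian_of_sub_one h
  have h1 : quadNorm P u ≤ quadNorm P (u + w.ofLp) + quadNorm P w.ofLp := by
    have := quadNorm_add_le (posSemidef_of_sub_one h) (u + w.ofLp) (-w.ofLp)
    rwa [quadNorm_neg, add_neg_cancel_right] at this
  have hmin : 0 < eigMin P := zero_lt_one.trans_le (one_le_eigMin hn h)
  have h2 : quadNorm P w.ofLp ≤ √(eigMax P) * W := by
    have e1 := le_eigMax_mul hP w.ofLp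
    rw [dotProduct_self_eq_norm_sq] at e1
    rw [quadNorm]
    refine (Real.sqrt_le_sqrt e1).trans ?_
    rw [Real.sqrt_mul' _ (by positivity), Real.sqrt_sq (norm_nonneg _)]
    gcongr
  have h3 : √(eigMin P) ≤ quadNorm P x.ofLp := by
    have e1 := eigMin_mul_le hP x.ofLp
    rw [dotProduct_self_eq_norm_sq, hx, one_pow, mul_one] at e1
    exact Real.sqrt_le_sqrt e1
  -- The eigenvalue ratio converts the bound on the noise into a multiple of ‖x‖_P, using ‖x‖_P ≥
  -- √λmin on the sphere.
  have h4 : √(eigMax P) * W ≤ √(eigMax P / eigMin P) * W * quadNorm P x.ofLp := by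
    have e1 : √(eigMax P) = √(eigMax P / eigMin P) * √(eigMin P) := by
      rw [← Real.sqrt_mul' _ hmin.le, div_mul_cancel₀ _ hmin.ne']
    calc √(eigMax P) * W = √(eigMax P / eigMin P) * W * √(eigMin P) := by rw [e1]; ring
      _ ≤ _ := by gcongr
  rw [lamBar, add_mul] at hu
  linarith

theorem quadForm_convex_comb (x y : Fin n → ℝ) {a b : ℝ} (hab : a + b = 1) :
    (a • x + b • y) ⬝ᵥ P *ᵥ (a • x + b • y) =
      a * (x ⬝ᵥ P *ᵥ x) + b * (y ⬝ᵥ P *ᵥ y) - a * b * ((x - y) ⬝ᵥ P *ᵥ (x - y)) := by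
  obtain rfl : b = 1 - a := by linarith
  simp only [mulVec_add, mulVec_sub, mulVec_smul, dotProduct_add, add_dotProduct, dotProduct_sub,
    sub_dotProduct, dotProduct_smul, smul_dotProduct, smul_eq_mul]
  ring

/-- The level sets of a positive definite quadratic polynomial are null sets. -/
theorem volume_quadForm_eq (hn : 0 < n) (h : (P - 1).PosSemidef) (u : Fin n → ℝ) (c : ℝ) :
    volume {w : EuclideanSpace ℝ (Fin n) | (u + w.ofLp) ⬝ᵥ P *ᵥ (u + w.ofLp) = c} = 0 := by
  have hpos := posSemidef_of_sub_one h
  set s : Set (EuclideanSpace ℝ (Fin n)) := {w | (u + w.ofLp) ⬝ᵥ P *ᵥ (u + w.ofLp) ≤ c} with hs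
  have hconv : Convex ℝ s := by
    intro x hx y hy a b ha hb hab
    simp only [hs, Set.mem_ofPred_eq] at hx hy ⊢
    have h1 : u + (a • x + b • y).ofLp = a • (u + x.ofLp) + b • (u + y.ofLp) := by
      simp only [WithLp.ofLp_add, WithLp.ofLp_smul, smul_add]
      calc _ = (a + b) • u + (a • x.ofLp + b • y.ofLp) := by rw [hab, one_smul]
        _ = _ := by rw [add_smul]; abel
    rw [h1, quadForm_convex_comb _ _ hab]
    have h2 := quadForm_nonneg hpos ((u + x.ofLp) - (u + y.ofLp))
    have h3 : 0 ≤ a * b * (((u + x.ofLp) - (u + y.ofLp)) ⬝ᵥ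
      P *ᵥ ((u + x.ofLp) - (u + y.ofLp))) := by positivity
    have h4 : a * ((u + x.ofLp) ⬝ᵥ P *ᵥ (u + x.ofLp)) +
        b * ((u + y.ofLp) ⬝ᵥ P *ᵥ (u + y.ofLp)) ≤ a * c + b * c := by gcongr
    rw [← add_mul, hab, one_mul] at h4
    linarith
  -- The level set lies in the frontier of the convex sublevel set, which is null.
  refine measure_mono_null ?_ (hconv.addHaar_frontier volume)
  intro w hw
  simp only [Set.mem_ofPred_eq] at hw
  rw [frontier_eq_closure_inter_closure]
  refine ⟨subset_closure (show w ∈ s from hw.le), ?_⟩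
  -- The form increases strictly when moving away from the centre -u, and along a basis vector when
  -- w is the centre.
  obtain ⟨z, hz⟩ : ∃ z : EuclideanSpace ℝ (Fin n), ∀ ε : ℝ, 0 < ε →
      c < (u + (w + ε • z).ofLp) ⬝ᵥ P *ᵥ (u + (w + ε • z).ofLp) := by
    by_cases hy : u + w.ofLp = 0
    · refine ⟨EuclideanSpace.single ⟨0, hn⟩ 1, fun ε hε => ?_⟩
      have hc : c = 0 := by rw [← hw, hy]; simp
      have h1 : u + (w + ε • EuclideanSpace.single (⟨0, hn⟩ : Fin n) (1 : ℝ)).ofLp =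
          (ε • EuclideanSpace.single (⟨0, hn⟩ : Fin n) (1 : ℝ)).ofLp := by
        rw [WithLp.ofLp_add, ← add_assoc, hy, zero_add]
      rw [h1, hc]
      refine lt_of_lt_of_le ?_ (dotProduct_self_le h _)
      rw [dotProduct_self_eq_norm_sq, norm_smul, PiLp.norm_single]
      simp only [Real.norm_eq_abs, norm_one, mul_one]
      positivity
    · refine ⟨WithLp.toLp 2 (u + w.ofLp), fun ε hε => ?_⟩
      have h1 : u + (w + ε • WithLp.toLp 2 (u + w.ofLp)).ofLp = (1 + ε) • (u + w.ofLp) := by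
        simp only [WithLp.ofLp_add, WithLp.ofLp_smul, add_smul, one_smul]; abel
      have h2 : 0 < c := by
        rw [← hw]
        refine lt_of_lt_of_le ?_ (dotProduct_self_le h _)
        have := dotProduct_self_star_pos_iff.2 hy
        simpa using this
      rw [h1, mulVec_smul, dotProduct_smul, smul_dotProduct, hw, smul_eq_mul, smul_eq_mul]
      nlinarith [mul_pos hε h2, mul_pos (mul_pos hε hε) h2]
  have htend : Filter.Tendsto (fun ε : ℝ => w + ε • z) (nhdsWithin 0 (Set.Ioi 0)) (nhds w) := by
    have : Continuous fun ε : ℝ => w + ε • z := by fun_prop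
    have := (this.tendsto 0).mono_left (nhdsWithin_le_nhds (s := Set.Ioi (0 : ℝ)))
    simpa using this
  refine mem_closure_of_tendsto htend ?_
  filter_upwards [self_mem_nhdsWithin] with ε hε
  exact not_le.2 (hz ε hε)

end Quadratic

/-! ### The space of symmetric matrices and the domain of P -/

section SymmetricMatrices

/-- The symmetric matrices, with the Frobenius norm. -/
def symMat (n : ℕ) : Submodule ℝ (EuclideanSpace ℝ (Fin n × Fin n)) where
  carrier := {f | ∀ i j, f (i, j) = f (j, i)}
  add_mem' := by
    intro f g hf hg i j
    simp [hf i j, hg i j]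
  zero_mem' := by simp
  smul_mem' := by
    intro c f hf i j
    simp [hf i j]

variable {n : ℕ}

/-- The matrix of an element of `symMat n`. -/
def symMat.toMatrix : symMat n →ₗ[ℝ] Matrix (Fin n) (Fin n) ℝ where
  toFun Q := Matrix.of fun i j => Q.1 (i, j)
  map_add' _ _ := rfl
  map_smul' _ _ := rfl

theorem symMat.isHermitian_toMatrix (Q : symMat n) : (symMat.toMatrix Q).IsHermitian := by
  ext i j
  exact Q.2 j i

theorem symMat.exists_toMatrix_eq {P : Matrix (Fin n) (Fin n) ℝ} (hP : P.IsHermitian) :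
    ∃ Q : symMat n, symMat.toMatrix Q = P := by
  refine ⟨⟨WithLp.toLp 2 fun x => P x.1 x.2, fun i j => ?_⟩, rfl⟩
  simpa using hP.apply j i

theorem symMat.norm_eq (Q : symMat n) : ‖Q‖ = frobNorm (symMat.toMatrix Q) := by
  rw [Submodule.coe_norm, EuclideanSpace.norm_eq, frobNorm, Fintype.sum_prod_type]
  simp only [Real.norm_eq_abs, sq_abs]
  rfl

/-- A symmetric matrix is determined by its values on unordered pairs of indices, of which there are
n(n+1)/2. -/
theorem symMat.finrank_le : Module.finrank ℝ (symMat n) ≤ n * (n + 1) / 2 := by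
  let f : symMat n →ₗ[ℝ] (Sym2 (Fin n) → ℝ) :=
    { toFun := fun Q z => Q.1 (Quot.out z)
      map_add' := fun _ _ => rfl
      map_smul' := fun _ _ => rfl }
  have hf : Function.Injective f := by
    intro Q R h
    ext ⟨i, j⟩
    have h1 : Q.1 (Quot.out s(i, j)) = R.1 (Quot.out s(i, j)) := congrFun h s(i, j)
    have h2 : s((Quot.out s(i, j)).1, (Quot.out s(i, j)).2) = s(i, j) := Quot.out_eq s(i, j)
    rcases Sym2.eq_iff.1 h2 with ⟨e1, e2⟩ | ⟨e1, e2⟩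
    · have : Quot.out s(i, j) = (i, j) := Prod.ext e1 e2
      rwa [this] at h1
    · have : Quot.out s(i, j) = (j, i) := Prod.ext e1 e2
      rw [this] at h1
      rw [Q.2 i j, R.2 i j]
      exact h1
  refine (LinearMap.finrank_le_finrank_of_injective hf).trans ?_
  rw [Module.finrank_fintype_fun_eq_card, Sym2.card, Fintype.card_fin, Nat.choose_two_right,
    Nat.add_sub_cancel, mul_comm]

/-- The value of the quadratic form of a symmetric matrix at `v`. -/
def quadEval (v : Fin n → ℝ) : symMat n →ₗ[ℝ] ℝ where
  toFun Q := v ⬝ᵥ (symMat.toMatrix Q) *ᵥ v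
  map_add' Q R := by rw [map_add, add_mulVec, dotProduct_add]
  map_smul' c Q := by rw [map_smul, smul_mulVec, dotProduct_smul]; rfl

theorem continuous_quadEval : Continuous fun x : (Fin n → ℝ) × symMat n => quadEval x.1 x.2 := by
  have : (fun x : (Fin n → ℝ) × symMat n => quadEval x.1 x.2) =
      fun x => ∑ i, x.1 i * ∑ j, x.2.1 (i, j) * x.1 j := rfl
  rw [this]
  have h : ∀ i j, Continuous fun x : (Fin n → ℝ) × symMat n => x.2.1 (i, j) := fun i j => by
    fun_prop
  fun_prop

/-- The symmetric matrices `P ⪰ I` of Frobenius norm at most `C`. -/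
def matDomain (n : ℕ) (C : ℝ) : Set (symMat n) :=
  {Q | ((symMat.toMatrix Q) - 1).PosSemidef ∧ ‖Q‖ ≤ C}

/-- Presents P ⪰ I as an intersection of closed half-spaces, whence closedness and convexity of the
domain. -/
theorem sub_one_posSemidef_iff (Q : symMat n) :
    ((symMat.toMatrix Q) - 1).PosSemidef ↔ ∀ v, v ⬝ᵥ v ≤ quadEval v Q := by
  refine ⟨fun h v => dotProduct_self_le h v, fun h =>
    PosSemidef.of_dotProduct_mulVec_nonneg
      ((symMat.isHermitian_toMatrix Q).sub isHermitian_one) fun v => ?_⟩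
  rw [star_trivial, sub_mulVec, dotProduct_sub, one_mulVec]
  exact sub_nonneg.2 (h v)

theorem isCompact_matDomain (C : ℝ) : IsCompact (matDomain n C) := by
  refine Metric.isCompact_of_isClosed_isBounded ?_ ?_
  · have : matDomain n C = (⋂ v : Fin n → ℝ, {Q | v ⬝ᵥ v ≤ quadEval v Q}) ∩ {Q | ‖Q‖ ≤ C} := by
      ext Q
      simp [matDomain, sub_one_posSemidef_iff]
    rw [this]
    refine (isClosed_iInter fun v => isClosed_le continuous_const ?_).inter
      (isClosed_le continuous_norm continuous_const)
    exact continuous_quadEval.comp (Continuous.prodMk_right v)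
  · exact isBounded_iff_forall_norm_le.2 ⟨C, fun Q hQ => hQ.2⟩

theorem convex_matDomain (C : ℝ) : Convex ℝ (matDomain n C) := by
  intro Q hQ R hR a b ha hb hab
  refine ⟨(sub_one_posSemidef_iff _).2 fun v => ?_, ?_⟩
  · have h1 := (sub_one_posSemidef_iff _).1 hQ.1 v
    have h2 := (sub_one_posSemidef_iff _).1 hR.1 v
    rw [map_add, map_smul, map_smul, smul_eq_mul, smul_eq_mul]
    calc v ⬝ᵥ v = a * (v ⬝ᵥ v) + b * (v ⬝ᵥ v) := by rw [← add_mul, hab, one_mul]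
      _ ≤ _ := by gcongr
  · have := convex_closedBall (0 : symMat n) C (x := Q) (by simpa using hQ.2) (y := R)
      (by simpa using hR.2) ha hb hab
    simpa using this

/-- The identity matrix has Frobenius norm √n. -/
theorem nonempty_matDomain {C : ℝ} (hC : √(n : ℝ) ≤ C) : (matDomain n C).Nonempty := by
  obtain ⟨Q, hQ⟩ := symMat.exists_toMatrix_eq (isHermitian_one (n := Fin n) (α := ℝ))
  refine ⟨Q, by rw [hQ, sub_self]; exact PosSemidef.zero, ?_⟩
  rw [symMat.norm_eq Q, hQ, frobNorm]
  simpa [Matrix.one_apply, ite_pow] using hC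

theorem trace_pos_of_mem_matDomain (hn : 0 < n) {C : ℝ} {Q : symMat n} (hQ : Q ∈ matDomain n C) :
    0 < (symMat.toMatrix Q).trace := by
  have := hQ.1.trace_nonneg
  rw [trace_sub, trace_one, Fintype.card_fin] at this
  have : (0 : ℝ) < n := by exact_mod_cast hn
  linarith

end SymmetricMatrices

/-! ### The sampled program as a scenario program -/

section Program

variable {U E : Type*} {m n l : ℕ} {W : ℝ} (G : LabeledGraph U E m)
  (A : Fin m → Matrix (Fin n) (Fin n) ℝ)

/-- The noisy successor state `A_σ x + w` of a sample. -/
def successor (δ : Sample G n l W) : Fin n → ℝ :=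
  wordMatrix A δ.2.1.1 *ᵥ δ.1.1.ofLp + δ.2.2.1.ofLp

theorem continuous_successor : Continuous (successor G A (l := l) (W := W)) := by
  unfold successor
  have h1 : Continuous fun δ : Sample G n l W => wordMatrix A δ.2.1.1 :=
    (continuous_of_discreteTopology (f := fun σ : G.language l => wordMatrix A σ.1)).comp
      (continuous_fst.comp continuous_snd)
  have h2 : Continuous fun δ : Sample G n l W => δ.1.1.ofLp := by fun_prop
  have h3 : Continuous fun δ : Sample G n l W => δ.2.2.1.ofLp := by fun_prop
  exact (h1.matrix_mulVec h2).add h3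

/-- The sampled program, in terms of `t = lam ^ (2 * l)`. -/
def stabilityProgram (l : ℕ) (W : ℝ) (hn : 0 < n) {C : ℝ} (hC : √(n : ℝ) ≤ C) :
    ScenarioProgram (Sample G n l W) (symMat n) where
  a δ := quadEval (successor G A δ)
  b δ := quadEval δ.1.1.ofLp
  X := matDomain n C
  T := Matrix.traceLinearMap (Fin n) ℝ ℝ ∘ₗ symMat.toMatrix
  isCompact_X := isCompact_matDomain C
  convex_X := convex_matDomain C
  nonempty_X := nonempty_matDomain hC
  a_nonneg _ _ hQ := quadForm_nonneg (posSemidef_of_sub_one hQ.1) _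
  one_le_b δ Q hQ := by
    have h1 := (sub_one_posSemidef_iff Q).1 hQ.1 δ.1.1.ofLp
    have h2 : ‖δ.1.1‖ = 1 := mem_sphere_zero_iff_norm.1 δ.1.2
    rwa [dotProduct_self_eq_norm_sq, h2, one_pow] at h1
  T_pos _ hQ := trace_pos_of_mem_matDomain hn hQ
  continuous_a := continuous_quadEval.comp
    (((continuous_successor G A).comp continuous_fst).prodMk continuous_snd)
  continuous_b := by
    have : Continuous fun x : Sample G n l W × symMat n => (x.1.1.1.ofLp, x.2) := by fun_prop
    exact continuous_quadEval.comp this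

variable {G A} {hn : 0 < n} {C : ℝ} {hC : √(n : ℝ) ≤ C}

/-- Squaring makes the constraint linear in P for a fixed level. -/
theorem quadNorm_le_iff {P : Matrix (Fin n) (Fin n) ℝ} (hP : P.PosSemidef) {lam : ℝ}
    (hlam : 0 ≤ lam) (u x : Fin n → ℝ) :
    quadNorm P u ≤ lam ^ l * quadNorm P x ↔
      u ⬝ᵥ P *ᵥ u ≤ lam ^ (2 * l) * (x ⬝ᵥ P *ᵥ x) := by
  have h1 := quadForm_nonneg hP x
  have h2 : lam ^ l * quadNorm P x = √(lam ^ (2 * l) * (x ⬝ᵥ P *ᵥ x)) := by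
    rw [Real.sqrt_mul (by positivity), mul_comm 2 l, pow_mul, Real.sqrt_sq (by positivity)]
    rfl
  rw [h2, quadNorm, Real.sqrt_le_sqrt_iff (by positivity)]

theorem isFeasible_toMatrix_iff {N : ℕ} {ω : Fin N → Sample G n l W} {lam : ℝ} {Q : symMat n} :
    IsFeasible G A C ω lam (symMat.toMatrix Q) ↔ 0 ≤ lam ∧
      (stabilityProgram G A l W hn hC).Feasible (Set.range ω) (lam ^ (2 * l), Q) := by
  unfold IsFeasible ScenarioProgram.Feasible
  simp only [Set.forall_mem_range]
  constructor
  · rintro ⟨h0, h1, h2, h3⟩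
    refine ⟨h0, by positivity, ⟨h1, by rwa [symMat.norm_eq Q]⟩, fun i => ?_⟩
    exact (quadNorm_le_iff (posSemidef_of_sub_one h1) h0 _ _).1 (h3 i)
  · rintro ⟨h0, -, ⟨h1, h2⟩, h3⟩
    refine ⟨h0, h1, by rwa [← symMat.norm_eq Q], fun i => ?_⟩
    exact (quadNorm_le_iff (posSemidef_of_sub_one h1) h0 _ _).2 (h3 i)

theorem exists_pow_eq (hl : 0 < l) {t : ℝ} (ht : 0 ≤ t) : ∃ lam : ℝ, 0 ≤ lam ∧ lam ^ (2 * l) = t :=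
  ⟨t ^ (((2 * l : ℕ) : ℝ)⁻¹), by positivity, Real.rpow_inv_natCast_pow ht (by omega)⟩

/-- For l > 0 the map λ ↦ λ^(2l) is an increasing bijection of [0, ∞), so it preserves the
lexicographic order. -/
theorem isSolution_toMatrix_iff (hl : 0 < l) {N : ℕ} {ω : Fin N → Sample G n l W} {lam : ℝ}
    {Q : symMat n} :
    IsSolution G A C ω lam (symMat.toMatrix Q) ↔ 0 ≤ lam ∧
      (stabilityProgram G A l W hn hC).Optimal (Set.range ω) (lam ^ (2 * l), Q) := by
  have hl' : 2 * l ≠ 0 := by omega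
  have hlex : ∀ {lam lam' : ℝ} {Q Q' : symMat n}, 0 ≤ lam → 0 ≤ lam' →
      (toLex (lam, frobNorm (symMat.toMatrix Q)) ≤ toLex (lam', frobNorm (symMat.toMatrix Q')) ↔
        lam ^ (2 * l) < lam' ^ (2 * l) ∨ (lam ^ (2 * l) = lam' ^ (2 * l) ∧ ‖Q‖ ≤ ‖Q'‖)) := by
    intro lam lam' Q Q' h h'
    rw [Prod.Lex.toLex_le_toLex, pow_lt_pow_iff_left₀ h h' hl', pow_left_inj₀ h h' hl',
      symMat.norm_eq Q, symMat.norm_eq Q']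
  constructor
  · rintro ⟨hf, hmin⟩
    have hf' := isFeasible_toMatrix_iff (hn := hn) (hC := hC) |>.1 hf
    refine ⟨hf'.1, hf'.2, ?_⟩
    rintro ⟨t', Q'⟩ h'
    obtain ⟨lam', h0, rfl⟩ := exists_pow_eq hl h'.1
    exact (hlex hf'.1 h0).1 (hmin lam' _ (isFeasible_toMatrix_iff.2 ⟨h0, h'⟩))
  · rintro ⟨h0, hf, hmin⟩
    refine ⟨isFeasible_toMatrix_iff.2 ⟨h0, hf⟩, fun lam' P' h' => ?_⟩
    obtain ⟨Q', rfl⟩ := symMat.exists_toMatrix_eq (isHermitian_of_sub_one h'.2.1)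
    have hf' := isFeasible_toMatrix_iff (hn := hn) (hC := hC) |>.1 h'
    exact (hlex h0 hf'.1).2 (hmin _ hf'.2)

theorem existsUnique_isSolution (hn : 0 < n) (hC : √(n : ℝ) ≤ C) (hl : 0 < l) {N : ℕ}
    (ω : Fin N → Sample G n l W) :
    ∃! s : ℝ × Matrix (Fin n) (Fin n) ℝ, IsSolution G A C ω s.1 s.2 := by
  obtain ⟨⟨t, Q⟩, hopt⟩ := (stabilityProgram G A l W hn hC).exists_optimal (Set.range ω)
  obtain ⟨lam, h0, rfl⟩ := exists_pow_eq hl hopt.1.1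
  refine ⟨(lam, (symMat.toMatrix Q)), (isSolution_toMatrix_iff hl).2 ⟨h0, hopt⟩, ?_⟩
  rintro ⟨lam', P'⟩ h'
  obtain ⟨Q', rfl⟩ := symMat.exists_toMatrix_eq (isHermitian_of_sub_one h'.1.2.1)
  have h2 := isSolution_toMatrix_iff (hn := hn) (hC := hC) hl |>.1 h'
  have h3 := Prod.ext_iff.1 (h2.2.eq hopt)
  exact Prod.ext ((pow_left_inj₀ h2.1 h0 (by omega)).1 h3.1) (congrArg symMat.toMatrix h3.2)

theorem isProbabilityMeasure_sphereUniform (hn : 0 < n) :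
    IsProbabilityMeasure (sphereUniform n) := by
  have : Nonempty (Fin n) := ⟨⟨0, hn⟩⟩
  constructor
  rw [sphereUniform, Measure.smul_apply, smul_eq_mul]
  refine ENNReal.inv_mul_cancel ?_ (measure_ne_top _ _)
  rw [Measure.toSphere_apply_univ, finrank_euclideanSpace_fin]
  refine mul_ne_zero (by exact_mod_cast hn.ne') (Metric.measure_ball_pos _ _ one_pos).ne'

theorem isProbabilityMeasure_sampleMeasure (hn : 0 < n) (hG : (G.language l).Nonempty)
    (μw : Measure (Metric.closedBall (0 : EuclideanSpace ℝ (Fin n)) W))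
    [IsProbabilityMeasure μw] : IsProbabilityMeasure (sampleMeasure G n l μw) := by
  have := isProbabilityMeasure_sphereUniform hn
  have : Nonempty (G.language l) := hG.to_subtype
  have := ProbabilityTheory.isProbabilityMeasure_uniformOn
    (Set.finite_univ (α := G.language l)) Set.univ_nonempty
  unfold sampleMeasure
  infer_instance

/-- For fixed x and σ the active noise vectors lie on a Lebesgue-null level set of a quadratic,
which `hμw` forces to be μw-null; Fubini concludes. -/
theorem sampleMeasure_active (hG : (G.language l).Nonempty)
    (μw : Measure (Metric.closedBall (0 : EuclideanSpace ℝ (Fin n)) W))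
    [IsProbabilityMeasure μw]
    (hμw : ∀ S : Set (Metric.closedBall (0 : EuclideanSpace ℝ (Fin n)) W),
      0 < μw S → volume (Subtype.val '' S) ≠ 0)
    {θ : ℝ × symMat n} (hθ : θ.2 ∈ matDomain n C) :
    sampleMeasure G n l μw ((stabilityProgram G A l W hn hC).active θ) = 0 := by
  set p := stabilityProgram G A l W hn hC
  have : Nonempty (G.language l) := hG.to_subtype
  have := ProbabilityTheory.isProbabilityMeasure_uniformOn
    (Set.finite_univ (α := G.language l)) Set.univ_nonempty
  have hm : MeasurableSet (p.active θ) := measurable_prodMk_left p.measurableSet_active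
  unfold sampleMeasure
  rw [Measure.measure_prod_null hm]
  refine Filter.Eventually.of_forall fun x => ?_
  rw [Pi.zero_apply, Measure.measure_prod_null (measurable_prodMk_left hm)]
  refine Filter.Eventually.of_forall fun σ => ?_
  rw [Pi.zero_apply]
  by_contra hne
  refine hμw _ (pos_iff_ne_zero.2 hne) (measure_mono_null ?_
    (volume_quadForm_eq hn hθ.1 (wordMatrix A σ.1 *ᵥ x.1.ofLp)
      (θ.1 * quadEval x.1.ofLp θ.2)))
  rintro _ ⟨w, hw, rfl⟩
  exact hw

theorem violationSet_subset (hW : 0 ≤ W) {lam : ℝ} (hlam : 0 ≤ lam) {Q : symMat n}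
    (hQ : Q ∈ matDomain n C) :
    violationSet G A l W lam (symMat.toMatrix Q) ⊆
      ((stabilityProgram G A l W hn hC).sat (lam ^ (2 * l), Q))ᶜ := by
  intro δ hδ hsat
  have h1 : ‖δ.1.1‖ = 1 := mem_sphere_zero_iff_norm.1 δ.1.2
  have h2 : ‖δ.2.2.1‖ ≤ W := mem_closedBall_zero_iff.1 δ.2.2.2
  have h3 := quadNorm_add_gt hn hQ.1 hW h1 h2 hδ
  exact h3.not_ge ((quadNorm_le_iff (posSemidef_of_sub_one hQ.1) hlam _ _).2 hsat)

end Program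

end CSLS

end

/-! ### The main theorem -/

theorem mainTheorem5 {U E : Type*} [Finite U] [Finite E] {m n l N : ℕ}
    (hn : 0 < n) (hl : 0 < l)
    (G : CSLS.LabeledGraph U E m) (A : Fin m → Matrix (Fin n) (Fin n) ℝ)
    (hG : (G.language l).Nonempty)
    (C : ℝ) (hC : √(n : ℝ) ≤ C) (W : ℝ) (hW : 0 < W)
    (μw : MeasureTheory.Measure (Metric.closedBall (0 : EuclideanSpace ℝ (Fin n)) W))
    [MeasureTheory.IsProbabilityMeasure μw]
    (hμw : ∀ S : Set (Metric.closedBall (0 : EuclideanSpace ℝ (Fin n)) W),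
      0 < μw S → MeasureTheory.volume (Subtype.val '' S) ≠ 0)
    (hN : n * (n + 1) / 2 ≤ N)
    (β : ℝ) (hβ₀ : 0 < β) (hβ₁ : β < 1) :
    (∀ ω : Fin N → CSLS.Sample G n l W,
      ∃! s : ℝ × Matrix (Fin n) (Fin n) ℝ, CSLS.IsSolution G A C ω s.1 s.2) ∧
    ∀ (lamStar : (Fin N → CSLS.Sample G n l W) → ℝ)
      (PStar : (Fin N → CSLS.Sample G n l W) → Matrix (Fin n) (Fin n) ℝ),
      (∀ ω, CSLS.IsSolution G A C ω (lamStar ω) (PStar ω)) →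
      ENNReal.ofReal (1 - β) ≤
        MeasureTheory.Measure.pi (fun _ : Fin N => CSLS.sampleMeasure G n l μw)
          {ω | CSLS.sampleMeasure G n l μw
              (CSLS.violationSet G A l W (lamStar ω) (PStar ω))
            ≤ ENNReal.ofReal (CSLS.epsBound (n * (n + 1) / 2) β N)} := by
  refine ⟨fun ω => CSLS.existsUnique_isSolution hn hC hl ω, fun lamStar PStar hsol => ?_⟩
  have hprob := CSLS.isProbabilityMeasure_sampleMeasure hn hG μw
  set π := CSLS.sampleMeasure G n l μw
  set d := n * (n + 1) / 2
  have hd0 : 0 < d := by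
    have : 2 ≤ n * (n + 1) := by nlinarith
    omega
  set p := CSLS.stabilityProgram G A l W hn hC
  obtain ⟨hε0, hε1, hε⟩ := CSLS.epsBound_spec hd0 hN hβ₀ hβ₁
  set ε := CSLS.epsBound d β N
  have hbound := CSLS.ScenarioProgram.measure_conf_lt_le (p := p) π CSLS.symMat.finrank_le hd0
    (fun θ _ hθ => CSLS.sampleMeasure_active hG μw hμw hθ) hN hε0 hε1
  rw [hε, sub_sub_cancel] at hbound
  set μ := MeasureTheory.Measure.pi fun _ : Fin N => π
  set S := {ω : Fin N → CSLS.Sample G n l W |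
    π (CSLS.violationSet G A l W (lamStar ω) (PStar ω)) ≤ ENNReal.ofReal ε}
  have hsub : Sᶜ ⊆ {ω | p.conf π (p.sol (Set.range ω)) < 1 - ε} := by
    intro ω hω
    by_contra hc
    apply hω
    have hs := hsol ω
    obtain ⟨Q, hQ⟩ := CSLS.symMat.exists_toMatrix_eq (CSLS.isHermitian_of_sub_one hs.1.2.1)
    rw [← hQ] at hs
    have h1 := (CSLS.isSolution_toMatrix_iff (hn := hn) (hC := hC) hl).1 hs
    have hc' : 1 - ε ≤ π.real (p.sat (lamStar ω ^ (2 * l), Q)) := by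
      have : 1 - ε ≤ p.conf π (p.sol (Set.range ω)) := not_lt.1 hc
      rwa [h1.2.eq_sol] at this
    change π (CSLS.violationSet G A l W (lamStar ω) (PStar ω)) ≤ ENNReal.ofReal ε
    rw [← hQ]
    refine (MeasureTheory.measure_mono
      (CSLS.violationSet_subset (hn := hn) (hC := hC) hW.le h1.1 h1.2.1.2.1)).trans ?_
    have hm : MeasurableSet (p.sat (lamStar ω ^ (2 * l), Q)) :=
      measurable_prodMk_left p.measurableSet_sat
    rw [← MeasureTheory.ofReal_measureReal, MeasureTheory.probReal_compl_eq_one_sub hm]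
    exact ENNReal.ofReal_le_ofReal (by linarith)
  -- Subadditivity suffices here, so measurability of S is not needed.
  have h1 : (1 : ENNReal) ≤ μ S + ENNReal.ofReal β := by
    calc (1 : ENNReal) = μ Set.univ := MeasureTheory.measure_univ.symm
      _ = μ (S ∪ Sᶜ) := by rw [Set.union_compl_self]
      _ ≤ μ S + μ Sᶜ := MeasureTheory.measure_union_le _ _
      _ ≤ _ := by gcongr; exact (MeasureTheory.measure_mono hsub).trans hbound
  rw [ENNReal.ofReal_sub _ hβ₀.le, ENNReal.ofReal_one]
  exact tsub_le_iff_right.2 h1
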